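/- Let $S=K[x_1,\ldots,x_N]$ be a polynomial ring over a field $K$, let $u\in S$ be a squarefree monomial, and let $I=B_1(u)$ be the squarefree principal Borel ideal with Borel generator $u$, that is, the smallest ideal of $S$ that contains $u$, is generated by squarefree monomials, and contains with each squarefree monomial $v$ also $x_i(v/x_j)$ whenever $x_j\mid v$, $i<j$ and $x_i(v/x_j)$ is squarefree. For $k\ge 0$ let $\mathrm{HS}_k(I)$ be the $k$th homological shift ideal of $I$, i.e. the ideal generated by the monomials $\mathbf x^{\mathbf a}$, where $\mathbf a$ runs over the multigraded shifts in homological degree $k$ of the minimal multigraded free $S$-resolution of $I$ (so $\mathrm{HS}_0(I)=I$). Let $e(M)$ denote the multiplicity of a finitely generated graded $S$-module $M$, with $e(0)=0$. Then $k\mapsto e(S/\mathrm{HS}_k(I))$, $k\geq 0$, is a unimodal function: there is an $m$ such that it is nondecreasing for $k\le m$ and nonincreasing for $k\ge m$. More precisely, suppose $u\neq 1$. Put $n=\max\{i : x_i\mid u\}$, let $[a,b]=\{a,a+1,\ldots,b\}$ be the first block of $u$ (that is, $a=\min\{i: x_i\mid u\}$, and $b$ is the largest integer such that $x_a,x_{a+1},\ldots,x_b$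 all divide $u$), call $i<n$ a gap of $u$ if $x_i\nmid u$, let $g$ be the number of gaps of $u$, and let $k_0+1\geq 0$ be the number of gaps of $u$ that are larger than $b$. Then $$e(S/\mathrm{HS}_k(I))=\begin{cases}\binom{b}{a}, & 0\le k\le k_0,\\[2pt] \binom{n}{a-(k-k_0-1)}, & k_0<k\le g,\\[2pt] 1, & k>g.\end{cases}$$ -/

import Mathlib

noncomputable section

namespace SquarefreeBorel

open MvPolynomial

variable {n : ℕ} {K : Type*} [Field K]

/-! A monomial of `S = K[x₁, …, xₙ]` is given by its exponent vector `u : Fin n →₀ ℕ`; the index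
`i : Fin n` stands for the variable `x_{i+1}`. -/

/-- The monomial with exponent vector `u` is `k`-bounded. -/
def KBounded (k : ℕ) (u : Fin n →₀ ℕ) : Prop :=
  ∀ i, u i ≤ k

/-- `I` is a monomial ideal generated by `k`-bounded monomials. -/
def IsKBoundedIdeal (k : ℕ) (I : Ideal (MvPolynomial (Fin n) K)) : Prop :=
  ∃ G : Set (Fin n →₀ ℕ), (∀ u ∈ G, KBounded k u) ∧
    I = Ideal.span ((fun u => monomial u (1 : K)) '' G)

/-- `I` is a `k`-Borel ideal: a `k`-bounded monomial ideal such that for each `k`-bounded monomial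
`u ∈ I`, each `j ∈ supp(u)` and `i < j`, the monomial `x_i (u / x_j)` is in `I` if it is
`k`-bounded. -/
def IsKBorel (k : ℕ) (I : Ideal (MvPolynomial (Fin n) K)) : Prop :=
  IsKBoundedIdeal k I ∧
    ∀ u : Fin n →₀ ℕ, KBounded k u → monomial u (1 : K) ∈ I →
      ∀ j ∈ u.support, ∀ i < j,
        KBounded k (u - Finsupp.single j 1 + Finsupp.single i 1) →
          monomial (u - Finsupp.single j 1 + Finsupp.single i 1) (1 : K) ∈ I

/-- `B_k(u)`: the intersection of all `k`-Borel ideals of `K[x₁, …, xₙ]` that contain `u`. -/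
def principalBorel (K : Type*) [Field K] (k : ℕ) (u : Fin n →₀ ℕ) :
    Ideal (MvPolynomial (Fin n) K) :=
  sInf {J | IsKBorel k J ∧ monomial u (1 : K) ∈ J}

/-- A minimal multigraded free `S`-resolution `⋯ → F₁ → F₀ → I → 0` with
`F_i = ⨁_{j ∈ ι i} S(-shift i j)` of finite rank. The basis element `e_j` of `F_i` is
`Finsupp.single j 1`; it has multidegree `shift i j`. -/
structure MinMultigradedResolution (I : Ideal (MvPolynomial (Fin n) K)) where
  /-- the index set of the basis of `F_i` -/
  ι : ℕ → Type
  finite_ι : ∀ i, Finite (ι i)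
  /-- the multigraded shifts -/
  shift : ∀ i, ι i → (Fin n →₀ ℕ)
  /-- the differential `F_{i+1} → F_i` -/
  d : ∀ i, (ι (i + 1) →₀ MvPolynomial (Fin n) K) →ₗ[MvPolynomial (Fin n) K]
    (ι i →₀ MvPolynomial (Fin n) K)
  /-- the augmentation `F₀ → I ⊆ S` -/
  ε : (ι 0 →₀ MvPolynomial (Fin n) K) →ₗ[MvPolynomial (Fin n) K] MvPolynomial (Fin n) K
  range_ε : LinearMap.range ε = I
  exact_ε : Function.Exact (d 0) ε
  exact_d : ∀ i, Function.Exact (d (i + 1)) (d i)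
  /-- the augmentation is multihomogeneous of degree `0` -/
  homogeneous_ε : ∀ j, ∃ c : K, ε (Finsupp.single j 1) = monomial (shift 0 j) c
  /-- the differentials are multihomogeneous of degree `0`: the `l`-th coordinate of `d e_j` is a
  scalar multiple of the quotient of the monomials of degrees `shift (i+1) j` and `shift i l`, and
  is `0` if the latter does not divide the former -/
  homogeneous_d : ∀ i (j : ι (i + 1)) (l : ι i), ∃ c : K,
    d i (Finsupp.single j 1) l * monomial (shift i l) 1 = monomial (shift (i + 1) j) c
  /-- minimality: `d F_{i+1} ⊆ (x₁, …, xₙ) F_i` -/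
  minimal : ∀ i (j : ι (i + 1)) (l : ι i), constantCoeff (d i (Finsupp.single j 1) l) = 0

/-- The homological shift ideal `HS_k(I)`, generated by the monomials `x^a` where `a` runs over the
multigraded shifts in homological degree `k` of a minimal multigraded free resolution of `I`. (Any
two such resolutions are isomorphic; no choice is made here.) -/
def homologicalShift (k : ℕ) (I : Ideal (MvPolynomial (Fin n) K)) :
    Ideal (MvPolynomial (Fin n) K) :=
  Ideal.span {p | ∃ (F : MinMultigradedResolution I) (j : F.ι k),
    p = monomial (F.shift k j) (1 : K)}

/-- The Hilbert function of `S/I`: the `K`-dimension of the image in `S/I` of the space of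
homogeneous polynomials of degree `t`. -/
def hilbertFunction (I : Ideal (MvPolynomial (Fin n) K)) (t : ℕ) : ℕ :=
  Module.finrank K
    ((homogeneousSubmodule (Fin n) K t).map (Ideal.Quotient.mkₐ K I).toLinearMap)

/-- The Hilbert series of `S/I`. -/
def hilbertSeries (I : Ideal (MvPolynomial (Fin n) K)) : PowerSeries ℤ :=
  PowerSeries.mk fun t => (hilbertFunction I t : ℤ)

/-- `Q` is the numerator of the Hilbert series `Q(z) / (1 - z)^D` of `S/I`, with `D` the Krull
dimension of `S/I`. -/
def IsHilbertNumerator (I : Ideal (MvPolynomial (Fin n) K)) (Q : Polynomial ℤ) : Prop :=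
  ∃ D : ℕ, ringKrullDim (MvPolynomial (Fin n) K ⧸ I) = (D : WithBot ℕ∞) ∧
    (Q : PowerSeries ℤ) = hilbertSeries I * (1 - PowerSeries.X) ^ D

open Classical in
/-- The multiplicity `e(S/I) = Q(1)` of `S/I`, for a graded ideal `I`, where the Hilbert series of
`S/I` is `Q(z) / (1 - z)^(dim S/I)`. The zero module has multiplicity `0`. -/
def mult (I : Ideal (MvPolynomial (Fin n) K)) : ℤ :=
  if h : ∃ Q, IsHilbertNumerator I Q then h.choose.eval 1 else 0

/-- A sequence is unimodal: it is nondecreasing up to some index and nonincreasing from there. -/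
def Unimodal (f : ℕ → ℤ) : Prop :=
  ∃ m, MonotoneOn f (Set.Iic m) ∧ AntitoneOn f (Set.Ici m)

/-- `B` is a block of `u`: a nonempty set of consecutive indices inside the support. -/
def IsBlock (u : Fin n →₀ ℕ) (B : Finset (Fin n)) : Prop :=
  B ⊆ u.support ∧ ∃ i j, i ≤ j ∧ B = Finset.Icc i j

/-- `B` is the first block in the block decomposition of `u`: the maximal block that contains the
smallest element of the support. -/
def IsFirstBlock (u : Fin n →₀ ℕ) (B : Finset (Fin n)) : Prop :=
  Maximal (IsBlock u) B ∧ ∃ i ∈ B, ∀ s ∈ u.support, i ≤ s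

/-- `max(u)`, with the variables numbered from `1`. -/
def maxVar (u : Fin n →₀ ℕ) : ℕ :=
  u.support.sup fun i => (i : ℕ) + 1

open Classical in
/-- The gaps of `u`: the indices below `max(u)` that are not in the support. -/
def gaps (u : Fin n →₀ ℕ) : Finset (Fin n) :=
  Finset.univ.filter fun i => i ∉ u.support ∧ (i : ℕ) + 1 < maxVar u

/-- The number of gaps of `u` that are larger than `j`. -/
def numGapsAbove (u : Fin n →₀ ℕ) (j : Fin n) : ℕ :=
  ((gaps u).filter fun i => j < i).card

end SquarefreeBorel

end

/-! Number the variables from 1, write `U` for the support of `u` and `h` for the number of gaps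
above `b`, so that `g = a - 1 + h`.

The minimal generators of `I` are the squarefree monomials `w` of degree `|U|` such that each
initial segment `[1, t]` contains at least as many elements of `w` as of `U` (`principalBorel_eq`).
In colexicographic order they have linear quotients: the colon ideal at `w` is generated by the
variables in the gaps of `w`. Iterated mapping cones with Koszul complexes resolve `I` with degrees
`w ∪ σ`, where `σ` consists of `k` gaps of `w` (`IsShifted.hasResolution`). All these degrees have
size `|U| + k`, so the resolution is minimal, and minimal resolutions share their degrees; hence the
`w ∪ σ` generate `HS_k(I)` (`HasResolution.homologicalShift_eq`). Resolutions are handled one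
multidegree at a time: in multidegree `c` a free module is the vector space on the basis elements of
degree at most `c`.

A monomial with support `F` lies in `HS_k(I)` iff `F` has at least as many elements as `U` in `[1,
t]` for all `t < n`, and at least `|U| + k` in `[1, n]` (`exists_stableDegrees_le_iff`). The
multiplicity of a squarefree monomial quotient is the number of facets of maximal dimension, or of
vertex covers `C` of minimal size. Complementing, `C` is a cover iff for some `t < n` it has more
elements in `[1, t]` than `U` has gaps there, or it has more than `g - k` elements in `[1, n]`.

The number of gaps up to `t` is `t` before the first block, `a - 1` on it and at least `a` after it.
So covers of the first kind have at least `a` elements, and for `b < n` those with exactly `a` are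
the `a`-subsets of `[1, b]`. Minimal covers of the second kind are the subsets of `[1, n]` of size
`g - k + 1 = a + h - k`, or empty once `k > g`. For `k < h` the first kind wins, for `k ≥ h` the
second. The values are therefore constant, jump up from `C(b, a)` to `C(n, a)`, and then run down a
row of Pascal's triangle. -/

noncomputable section

namespace SquarefreeBorel

/-! ### Vector spaces with bases graded by a partial order. -/

section Filtered

variable {K : Type*} [Field K] {E : Type*} [PartialOrder E] {A B C : Type*}

/-- The span of the basis elements of degree at most `c`. -/
def fil (K : Type*) [Field K] (s : A → E) (c : E) : Submodule K (A →₀ K) :=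
  Finsupp.supported K K {j | s j ≤ c}

lemma mem_fil {s : A → E} {c : E} {x : A →₀ K} : x ∈ fil K s c ↔ ∀ j, x j ≠ 0 → s j ≤ c := by
  simp [fil, Finsupp.mem_supported, Set.subset_def]

lemma single_mem_fil {s : A → E} {c : E} {j : A} (a : K) (h : s j ≤ c) :
    Finsupp.single j a ∈ fil K s c :=
  Finsupp.single_mem_supported K a h

lemma fil_mono (s : A → E) {c c' : E} (h : c ≤ c') : fil K s c ≤ fil K s c' :=
  fun _ hx => mem_fil.2 fun j hj => (mem_fil.1 hx j hj).trans h

/-- A linear map between filtered spaces that respects the filtrations. -/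
def IsFiltered (s : A → E) (t : B → E) (f : (A →₀ K) →ₗ[K] (B →₀ K)) : Prop :=
  ∀ c, ∀ x ∈ fil K s c, f x ∈ fil K t c

lemma isFiltered_of_single {s : A → E} {t : B → E} {f : (A →₀ K) →ₗ[K] (B →₀ K)}
    (h : ∀ j, f (Finsupp.single j 1) ∈ fil K t (s j)) : IsFiltered s t f := by
  intro c x hx
  have hsum : f x = x.sum fun j a => a • f (Finsupp.single j 1) := by
    conv_lhs => rw [← Finsupp.sum_single x]
    rw [map_finsuppSum]
    refine Finsupp.sum_congr fun j _ => ?_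
    rw [← map_smul, Finsupp.smul_single, smul_eq_mul, mul_one]
  rw [hsum]
  refine Submodule.sum_mem _ fun j hj => Submodule.smul_mem _ _ ?_
  exact fil_mono t (mem_fil.1 hx j (Finsupp.mem_support_iff.1 hj)) (h j)

lemma IsFiltered.le {s : A → E} {t : B → E} {f : (A →₀ K) →ₗ[K] (B →₀ K)} (hf : IsFiltered s t f)
    {j : A} {l : B} (h : f (Finsupp.single j 1) l ≠ 0) : t l ≤ s j :=
  mem_fil.1 (hf _ _ (single_mem_fil 1 le_rfl)) l h

lemma apply_eq_sum_single {R A B : Type*} [CommSemiring R] (f : (A →₀ R) →ₗ[R] (B →₀ R))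
    (x : A →₀ R) (l : B) : f x l = x.sum fun j a => a * f (Finsupp.single j 1) l := by
  conv_lhs => rw [← Finsupp.sum_single x, map_finsuppSum]
  rw [Finsupp.sum_apply]
  refine Finsupp.sum_congr fun j _ => ?_
  rw [← mul_one (x j), ← smul_eq_mul, ← Finsupp.smul_single, map_smul]
  simp

/-- Graded projectivity of free modules: choose an admissible preimage for each basis element and
extend linearly. -/
lemma exists_filtered_lift {s : A → E} {t : B → E} (d : (B →₀ K) →ₗ[K] (C →₀ K))
    (g : (A →₀ K) →ₗ[K] (C →₀ K))
    (h : ∀ j, ∃ y ∈ fil K t (s j), d y = g (Finsupp.single j 1)) :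
    ∃ f : (A →₀ K) →ₗ[K] (B →₀ K), IsFiltered s t f ∧ ∀ x, d (f x) = g x := by
  choose y hy hd using h
  refine ⟨Finsupp.linearCombination K y, isFiltered_of_single fun j => ?_, fun x => ?_⟩
  · simpa using hy j
  · have : d ∘ₗ Finsupp.linearCombination K y = g := by
      ext j : 2
      simp [hd]
    exact LinearMap.congr_fun this x

end Filtered

/-! ### Complexes exact in each degree: comparison maps, minimality, mapping cones. -/

/-- The degreewise description of a complex of multigraded free modules over a polynomial ring, as
a complex of vector spaces with bases of elements of prescribed degrees, that is exact in all
positions except `0` in each degree. -/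
structure GradedComplex (K : Type*) [Field K] (E : Type*) [PartialOrder E] where
  /-- the index sets of the bases -/
  ι : ℕ → Type
  finite_ι : ∀ i, Finite (ι i)
  /-- the degrees of the basis elements -/
  deg : ∀ i, ι i → E
  /-- the differential -/
  d : ∀ i, (ι (i + 1) →₀ K) →ₗ[K] (ι i →₀ K)
  filtered_d : ∀ i, IsFiltered (deg (i + 1)) (deg i) (d i)
  d_d : ∀ i x, d i (d (i + 1) x) = 0
  exact_d : ∀ i c, ∀ x ∈ fil K (deg (i + 1)) c, d i x = 0 →
    ∃ y ∈ fil K (deg (i + 2)) c, d (i + 1) y = x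

namespace GradedComplex

variable {K : Type*} [Field K] {E : Type*} [PartialOrder E]

theorem exists_chainMap (P Q : GradedComplex K E) (f₀ : (P.ι 0 →₀ K) →ₗ[K] (Q.ι 0 →₀ K))
    (hf₀ : IsFiltered (P.deg 0) (Q.deg 0) f₀)
    (h₀ : ∀ c, ∀ y ∈ fil K (P.deg 1) c, ∃ z ∈ fil K (Q.deg 1) c, Q.d 0 z = f₀ (P.d 0 y)) :
    ∃ f : ∀ i, (P.ι i →₀ K) →ₗ[K] (Q.ι i →₀ K), f 0 = f₀ ∧
      (∀ i, IsFiltered (P.deg i) (Q.deg i) (f i)) ∧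
      ∀ i x, Q.d i (f (i + 1) x) = f i (P.d i x) := by
  -- Each stage carries, besides the map, the solvability of the next lifting problem, so the
  -- recursion can choose its successor.
  let St (i : ℕ) := {f : (P.ι i →₀ K) →ₗ[K] (Q.ι i →₀ K) // IsFiltered (P.deg i) (Q.deg i) f ∧
    ∀ c, ∀ y ∈ fil K (P.deg (i + 1)) c, ∃ z ∈ fil K (Q.deg (i + 1)) c, Q.d i z = f (P.d i y)}
  have step : ∀ i (s : St i), ∃ t : St (i + 1), ∀ x, Q.d i (t.1 x) = s.1 (P.d i x) := by
    rintro i ⟨f, hf, h⟩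
    obtain ⟨g, hg, hgd⟩ := exists_filtered_lift (s := P.deg (i + 1)) (t := Q.deg (i + 1))
      (Q.d i) (f ∘ₗ P.d i) fun j => h _ _ (single_mem_fil 1 le_rfl)
    refine ⟨⟨g, hg, fun c y hy => ?_⟩, hgd⟩
    refine Q.exact_d i c _ (hg _ _ (P.filtered_d _ _ _ hy)) ?_
    rw [hgd, LinearMap.comp_apply, P.d_d, map_zero]
  choose next hnext using step
  let F : ∀ i, St i := fun i => Nat.rec ⟨f₀, hf₀, h₀⟩ next i
  exact ⟨fun i => (F i).1, rfl, fun i => (F i).2.1, fun i x => hnext i (F i) x⟩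

/-- The nonzero entries of the differentials, with the possible exception of the one that ends in
position `0`, belong to basis elements of different degrees. -/
def IsMinimal (P : GradedComplex K E) : Prop :=
  ∀ i j l, P.d (i + 1) (Finsupp.single j 1) l ≠ 0 → P.deg (i + 1) l ≠ P.deg (i + 2) j

/-- A chain map lifting zero is null-homotopic, `f = d h' + h d`. A nonzero diagonal entry of either
product would pass through a basis element of the same degree, contradicting minimality of `d`. -/
theorem IsMinimal.chainMap_apply_self {P : GradedComplex K E} (hP : P.IsMinimal)
    (f : ∀ i, (P.ι i →₀ K) →ₗ[K] (P.ι i →₀ K))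
    (hf : ∀ i, IsFiltered (P.deg i) (P.deg i) (f i))
    (hfd : ∀ i x, P.d i (f (i + 1) x) = f i (P.d i x)) (hf₀ : f 0 = 0) (i : ℕ)
    (j : P.ι (i + 1)) : f (i + 1) (Finsupp.single j 1) j = 0 := by
  have lift : ∀ i (h : (P.ι i →₀ K) →ₗ[K] (P.ι (i + 1) →₀ K)),
      IsFiltered (P.deg i) (P.deg (i + 1)) h → (∀ x, P.d i (f (i + 1) x - h (P.d i x)) = 0) →
      ∃ h' : (P.ι (i + 1) →₀ K) →ₗ[K] (P.ι (i + 2) →₀ K),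
        IsFiltered (P.deg (i + 1)) (P.deg (i + 2)) h' ∧
        ∀ x, P.d (i + 1) (h' x) = f (i + 1) x - h (P.d i x) := by
    intro i h hh hd
    refine exists_filtered_lift (P.d (i + 1)) (f (i + 1) - h ∘ₗ P.d i) fun j => ?_
    refine P.exact_d i _ _ (Submodule.sub_mem _ ?_ ?_) (hd _)
    · exact hf _ _ _ (single_mem_fil 1 le_rfl)
    · exact hh _ _ (P.filtered_d _ _ _ (single_mem_fil 1 le_rfl))
  -- Starting the homotopy with `0` matters: minimality says nothing about the differential into
  -- position `0`, so the term `h d` must vanish there.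
  have key : ∀ i, ∃ h : (P.ι i →₀ K) →ₗ[K] (P.ι (i + 1) →₀ K),
      IsFiltered (P.deg i) (P.deg (i + 1)) h ∧ (i = 0 → h = 0) ∧
      ∀ x, P.d i (f (i + 1) x - h (P.d i x)) = 0 := by
    intro i
    induction i with
    | zero => exact ⟨0, fun c x _ => Submodule.zero_mem _, fun _ => rfl, fun x => by simp [hfd, hf₀]⟩
    | succ i ih =>
      obtain ⟨h, hh, -, hd⟩ := ih
      obtain ⟨h', hh', hd'⟩ := lift i h hh hd
      refine ⟨h', hh', by simp, fun x => ?_⟩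
      rw [map_sub, hd', hfd, P.d_d, map_zero, sub_zero, sub_self]
  obtain ⟨h, hh, h0, hd⟩ := key i
  obtain ⟨h', hh', hd'⟩ := lift i h hh hd
  have e1 : P.d (i + 1) (h' (Finsupp.single j 1)) j = 0 := by
    rw [apply_eq_sum_single]
    refine Finset.sum_eq_zero fun l hl => ?_
    by_contra hne
    have h1 := hh'.le (Finsupp.mem_support_iff.1 hl)
    have h2 := right_ne_zero_of_mul hne
    exact hP i l j h2 (le_antisymm ((P.filtered_d (i + 1)).le h2) h1)
  have e2 : h (P.d i (Finsupp.single j 1)) j = 0 := by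
    cases i with
    | zero => rw [h0 rfl]; rfl
    | succ i =>
      rw [apply_eq_sum_single]
      refine Finset.sum_eq_zero fun l hl => ?_
      by_contra hne
      have h1 := Finsupp.mem_support_iff.1 hl
      exact hP i j l h1 (le_antisymm ((P.filtered_d (i + 1)).le h1)
        (hh.le (right_ne_zero_of_mul hne)))
  have := DFunLike.congr_fun (hd' (Finsupp.single j 1)) j
  rw [e1, Finsupp.sub_apply, e2, sub_zero] at this
  exact this.symm

/-- Since `g f - id` lifts zero, the diagonal entries of `g f` are `1`. Some `l` then contributes
nonzero entries of both `f` and `g`, and filteredness bounds its degree from both sides. -/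
theorem IsMinimal.exists_deg_eq {P Q : GradedComplex K E} (hP : P.IsMinimal)
    (f : ∀ i, (P.ι i →₀ K) →ₗ[K] (Q.ι i →₀ K)) (g : ∀ i, (Q.ι i →₀ K) →ₗ[K] (P.ι i →₀ K))
    (hf : ∀ i, IsFiltered (P.deg i) (Q.deg i) (f i))
    (hg : ∀ i, IsFiltered (Q.deg i) (P.deg i) (g i))
    (hfd : ∀ i x, Q.d i (f (i + 1) x) = f i (P.d i x))
    (hgd : ∀ i x, P.d i (g (i + 1) x) = g i (Q.d i x))
    (h₀ : ∀ x, g 0 (f 0 x) = x) (i : ℕ) (j : P.ι (i + 1)) :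
    ∃ l, Q.deg (i + 1) l = P.deg (i + 1) j := by
  have h := hP.chainMap_apply_self (fun i => g i ∘ₗ f i - LinearMap.id)
    (fun i c x hx => Submodule.sub_mem _ (hg _ _ _ (hf _ _ _ hx)) hx)
    (fun i x => by simp [hfd, hgd]) (by ext x : 2; simp [h₀]) i j
  simp only [LinearMap.sub_apply, LinearMap.comp_apply, LinearMap.id_apply, Finsupp.sub_apply,
    Finsupp.single_eq_same] at h
  have h1 : g (i + 1) (f (i + 1) (Finsupp.single j 1)) j ≠ 0 := by
    rw [sub_eq_zero.1 h]; exact one_ne_zero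
  rw [apply_eq_sum_single] at h1
  obtain ⟨l, -, hl⟩ := Finset.exists_ne_zero_of_sum_ne_zero h1
  exact ⟨l, le_antisymm ((hf _).le (left_ne_zero_of_mul hl))
    ((hg _).le (right_ne_zero_of_mul hl))⟩

/-- The complex describes a free resolution of the quotient by the monomial ideal with set of
monomials `J`. -/
def Resolves [OrderBot E] (P : GradedComplex K E) (J : Set E) : Prop :=
  ∃ j₀ : P.ι 0, (∀ j, j = j₀) ∧ P.deg 0 j₀ = ⊥ ∧
    ∀ c, (∃ y ∈ fil K (P.deg 1) c, P.d 0 y ≠ 0) ↔ c ∈ J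

lemma exists_smul_eq_of_forall_eq {A : Type*} {j₀ : A} (h : ∀ j, j = j₀) {x : A →₀ K}
    (hx : x ≠ 0) (y : A →₀ K) : ∃ a : K, a • x = y := by
  have hx0 : x j₀ ≠ 0 := fun h0 => hx (Finsupp.ext fun j => by rw [h j, h0]; rfl)
  refine ⟨y j₀ / x j₀, Finsupp.ext fun j => ?_⟩
  rw [h j, Finsupp.smul_apply, smul_eq_mul, div_mul_cancel₀ _ hx0]

lemma exists_d_eq_of_mem [OrderBot E] {P : GradedComplex K E} {J : Set E} (hP : P.Resolves J)
    {c : E} (hc : c ∈ J) (x : P.ι 0 →₀ K) : ∃ y ∈ fil K (P.deg 1) c, P.d 0 y = x := by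
  obtain ⟨j₀, hj, -, h⟩ := hP
  obtain ⟨y, hy, hy0⟩ := (h c).2 hc
  obtain ⟨a, ha⟩ := exists_smul_eq_of_forall_eq hj hy0 x
  exact ⟨a • y, Submodule.smul_mem _ _ hy, by rw [map_smul, ha]⟩

/-- Of `P` only the inclusion of its monomials in `J` is required; this serves both to compare two
resolutions and to lift multiplication by a monomial for a cone. -/
theorem Resolves.exists_chainMap [OrderBot E] {P Q : GradedComplex K E} {J : Set E}
    (hQ : Q.Resolves J) (q₀ : Q.ι 0)
    (hP : ∀ c, ∀ y ∈ fil K (P.deg 1) c, P.d 0 y ≠ 0 → c ∈ J) :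
    ∃ f : ∀ i, (P.ι i →₀ K) →ₗ[K] (Q.ι i →₀ K),
      f 0 = Finsupp.lmapDomain K K (fun _ => q₀) ∧
      (∀ i, IsFiltered (P.deg i) (Q.deg i) (f i)) ∧
      ∀ i x, Q.d i (f (i + 1) x) = f i (P.d i x) := by
  refine GradedComplex.exists_chainMap P Q _ (isFiltered_of_single fun j => ?_) fun c y hy => ?_
  · rw [Finsupp.lmapDomain_apply, Finsupp.mapDomain_single]
    obtain ⟨j₀, hj, h0, -⟩ := hQ
    exact single_mem_fil _ (by rw [hj q₀, h0]; exact bot_le)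
  · by_cases h : P.d 0 y = 0
    · exact ⟨0, Submodule.zero_mem _, by rw [h, map_zero, map_zero]⟩
    · exact exists_d_eq_of_mem hQ (hP c y hy h) _

/-- The set of degrees in a minimal free resolution is contained in that of any other one. -/
theorem Resolves.exists_deg_eq [OrderBot E] {P Q : GradedComplex K E} {J : Set E}
    (hP : P.Resolves J) (hQ : Q.Resolves J) (hmin : P.IsMinimal) (i : ℕ) (j : P.ι (i + 1)) :
    ∃ l, Q.deg (i + 1) l = P.deg (i + 1) j := by
  have hP' := hP
  have hQ' := hQ
  obtain ⟨p₀, hp, -, hpJ⟩ := hP'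
  obtain ⟨q₀, hq, -, hqJ⟩ := hQ'
  obtain ⟨f, f0, hf, hfd⟩ := hQ.exists_chainMap (P := P) q₀ fun c y hy h => (hpJ c).1 ⟨y, hy, h⟩
  obtain ⟨g, g0, hg, hgd⟩ := hP.exists_chainMap (P := Q) p₀ fun c y hy h => (hqJ c).1 ⟨y, hy, h⟩
  refine hmin.exists_deg_eq f g hf hg hfd hgd (fun x => ?_) i j
  rw [f0, g0, Finsupp.lmapDomain_apply, Finsupp.lmapDomain_apply, ← Finsupp.mapDomain_comp]
  have : (fun _ : Q.ι 0 => p₀) ∘ (fun _ : P.ι 0 => q₀) = id := funext fun j => (hp j).symm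
  rw [this, Finsupp.mapDomain_id]

section Cone

/-- The index sets of the bases of a mapping cone. -/
abbrev coneι (P Q : GradedComplex K E) : ℕ → Type
  | 0 => P.ι 0
  | i + 1 => P.ι (i + 1) ⊕ Q.ι i

/-- The degrees of the basis elements of a mapping cone. -/
def coneDeg (P Q : GradedComplex K E) : ∀ i, coneι P Q i → E
  | 0 => P.deg 0
  | i + 1 => Sum.elim (P.deg (i + 1)) (Q.deg i)

/-- The decomposition of a mapping cone. -/
abbrev coneEquiv (P Q : GradedComplex K E) (i : ℕ) :
    (coneι P Q (i + 1) →₀ K) ≃ₗ[K] (P.ι (i + 1) →₀ K) × (Q.ι i →₀ K) :=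
  Finsupp.sumFinsuppLEquivProdFinsupp K

lemma mem_fil_coneDeg {P Q : GradedComplex K E} {i : ℕ} {c : E} {x : coneι P Q (i + 1) →₀ K} :
    x ∈ fil K (coneDeg P Q (i + 1)) c ↔
      (coneEquiv P Q i x).1 ∈ fil K (P.deg (i + 1)) c ∧
      (coneEquiv P Q i x).2 ∈ fil K (Q.deg i) c := by
  simp only [mem_fil, Sum.forall]
  rfl

/-- The differential of a mapping cone. -/
def coneD {P Q : GradedComplex K E} (f : ∀ i, (Q.ι i →₀ K) →ₗ[K] (P.ι i →₀ K)) :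
    ∀ i, (coneι P Q (i + 1) →₀ K) →ₗ[K] (coneι P Q i →₀ K)
  | 0 => (P.d 0).coprod (f 0) ∘ₗ (coneEquiv P Q 0).toLinearMap
  | i + 1 => (coneEquiv P Q i).symm.toLinearMap ∘ₗ
      ((P.d (i + 1)).coprod (f (i + 1))).prod (-(Q.d i ∘ₗ LinearMap.snd K _ _)) ∘ₗ
        (coneEquiv P Q (i + 1)).toLinearMap

lemma coneD_zero_apply {P Q : GradedComplex K E} (f : ∀ i, (Q.ι i →₀ K) →ₗ[K] (P.ι i →₀ K))
    (x : coneι P Q 1 →₀ K) : coneD f 0 x =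
      P.d 0 (coneEquiv P Q 0 x).1 + f 0 (coneEquiv P Q 0 x).2 := rfl

lemma coneEquiv_coneD {P Q : GradedComplex K E} (f : ∀ i, (Q.ι i →₀ K) →ₗ[K] (P.ι i →₀ K))
    (i : ℕ) (x : coneι P Q (i + 2) →₀ K) : coneEquiv P Q i (coneD f (i + 1) x) =
      (P.d (i + 1) (coneEquiv P Q (i + 1) x).1 + f (i + 1) (coneEquiv P Q (i + 1) x).2,
        -Q.d i (coneEquiv P Q (i + 1) x).2) := by
  simp only [coneD, LinearMap.comp_apply, LinearEquiv.coe_coe, LinearEquiv.apply_symm_apply]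
  rfl

/-- The mapping cone of a chain map that is injective on the homology in position `0`. -/
def cone (P Q : GradedComplex K E) (f : ∀ i, (Q.ι i →₀ K) →ₗ[K] (P.ι i →₀ K))
    (hf : ∀ i, IsFiltered (Q.deg i) (P.deg i) (f i))
    (hfd : ∀ i x, P.d i (f (i + 1) x) = f i (Q.d i x))
    (h₀ : ∀ c, ∀ x ∈ fil K (P.deg 1) c, ∀ y ∈ fil K (Q.deg 0) c, P.d 0 x = f 0 y →
      ∃ z ∈ fil K (Q.deg 1) c, Q.d 0 z = y) : GradedComplex K E where
  ι := coneι P Q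
  finite_ι i := by
    have := P.finite_ι
    have := Q.finite_ι
    cases i
    · exact P.finite_ι 0
    · exact inferInstanceAs (Finite (_ ⊕ _))
  deg := coneDeg P Q
  d := coneD f
  filtered_d i c x hx := by
    have hx := mem_fil_coneDeg.1 hx
    cases i with
    | zero =>
      rw [coneD_zero_apply]
      exact Submodule.add_mem _ (P.filtered_d _ _ _ hx.1) (hf _ _ _ hx.2)
    | succ i =>
      rw [mem_fil_coneDeg, coneEquiv_coneD]
      exact ⟨Submodule.add_mem _ (P.filtered_d _ _ _ hx.1) (hf _ _ _ hx.2),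
        Submodule.neg_mem _ (Q.filtered_d _ _ _ hx.2)⟩
  d_d i x := by
    cases i with
    | zero =>
      refine (coneD_zero_apply f _).trans ?_
      have h := coneEquiv_coneD f 0 x
      refine (congrArg (fun y => P.d 0 y.1 + f 0 y.2) h).trans ?_
      simp only [map_add, map_neg, P.d_d, hfd, zero_add, add_neg_cancel]
    | succ i =>
      apply (coneEquiv P Q i).injective
      refine (coneEquiv_coneD f i _).trans ?_
      have h := coneEquiv_coneD f (i + 1) x
      refine (congrArg (fun y => (P.d (i + 1) y.1 + f (i + 1) y.2, -Q.d i y.2)) h).trans ?_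
      simp only [map_add, map_neg, P.d_d, Q.d_d, hfd, zero_add, add_neg_cancel, neg_zero,
        Prod.mk_zero_zero, map_zero]
  exact_d i c x hx hd := by
    have hx := mem_fil_coneDeg.1 hx
    -- The `Q`-component is a boundary: by exactness of `Q`, or at the bottom by injectivity on
    -- homology. Correcting the `P`-component by `f z` makes it a cycle; the sign in the cone
    -- differential leads to the primitive `(y, -z)`.
    obtain ⟨z, hz, hzd, hxz⟩ : ∃ z ∈ fil K (Q.deg (i + 1)) c,
        Q.d i z = (coneEquiv P Q i x).2 ∧
          P.d i ((coneEquiv P Q i x).1 + f (i + 1) z) = 0 := by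
      cases i with
      | zero =>
        rw [coneD_zero_apply] at hd
        obtain ⟨z, hz, hzd⟩ := h₀ c _ (Submodule.neg_mem _ hx.1) _ hx.2
          (by rw [map_neg]; exact neg_eq_of_add_eq_zero_right hd)
        exact ⟨z, hz, hzd, by rw [map_add, hfd, hzd, hd]⟩
      | succ i =>
        have hd := congrArg (coneEquiv P Q i) hd
        rw [coneEquiv_coneD, map_zero, Prod.mk_eq_zero, neg_eq_zero] at hd
        obtain ⟨z, hz, hzd⟩ := Q.exact_d i c _ hx.2 hd.2
        exact ⟨z, hz, hzd, by rw [map_add, hfd, hzd, hd.1]⟩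
    obtain ⟨y, hy, hyd⟩ := P.exact_d i c _ (Submodule.add_mem _ hx.1 (hf _ _ _ hz)) hxz
    refine ⟨(coneEquiv P Q (i + 1)).symm (y, -z), ?_, ?_⟩
    · rw [mem_fil_coneDeg, LinearEquiv.apply_symm_apply]
      exact ⟨hy, Submodule.neg_mem _ hz⟩
    · apply (coneEquiv P Q i).injective
      rw [coneEquiv_coneD, LinearEquiv.apply_symm_apply]
      simp [hyd, hzd]

end Cone

end GradedComplex

/-! ### Squarefree exponent vectors and resolutions built by mapping cones. -/

variable {n : ℕ} {K : Type*} [Field K]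

/-- The exponent vector of the squarefree monomial with support `w`. -/
def ind (w : Finset (Fin n)) : Fin n →₀ ℕ :=
  Finsupp.equivFunOnFinite.symm fun i => if i ∈ w then 1 else 0

lemma ind_apply (w : Finset (Fin n)) (i : Fin n) : ind w i = if i ∈ w then 1 else 0 := rfl

@[simp] lemma ind_empty : ind (∅ : Finset (Fin n)) = 0 := by
  ext i; simp [ind_apply]

@[simp] lemma support_ind (w : Finset (Fin n)) : (ind w).support = w := by
  ext i; simp [ind_apply]

lemma ind_singleton (i : Fin n) : ind {i} = Finsupp.single i 1 := by
  ext j; simp [ind_apply, Finsupp.single_apply, eq_comm]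

lemma ind_union {v w : Finset (Fin n)} (h : Disjoint v w) : ind (v ∪ w) = ind v + ind w := by
  ext i
  by_cases hv : i ∈ v
  · simp [ind_apply, hv, Finset.disjoint_left.1 h hv]
  · simp [ind_apply, hv]

lemma degree_ind (w : Finset (Fin n)) : (ind w).degree = w.card := by
  rw [Finsupp.degree_eq_sum]
  simp [ind_apply]

lemma ind_le_iff {w : Finset (Fin n)} {c : Fin n →₀ ℕ} : ind w ≤ c ↔ w ⊆ c.support := by
  constructor
  · intro h i hi
    have := h i
    rw [ind_apply, if_pos hi] at this
    exact Finsupp.mem_support_iff.2 (by omega)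
  · intro h i
    rw [ind_apply]
    split_ifs with hi
    · exact Nat.one_le_iff_ne_zero.2 (Finsupp.mem_support_iff.1 (h hi))
    · exact Nat.zero_le _

namespace GradedComplex

/-- The complex with all degrees shifted by `v`. -/
abbrev shift (P : GradedComplex K (Fin n →₀ ℕ)) (v : Fin n →₀ ℕ) :
    GradedComplex K (Fin n →₀ ℕ) where
  ι := P.ι
  finite_ι := P.finite_ι
  deg i j := P.deg i j + v
  d := P.d
  filtered_d i := isFiltered_of_single fun j => mem_fil.2 fun _ hl =>
    add_le_add_left ((P.filtered_d i).le hl) v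
  d_d := P.d_d
  exact_d i c x hx hd := by
    by_cases h : v ≤ c
    · obtain ⟨y, hy, hyd⟩ := P.exact_d i (c - v) x
        (mem_fil.2 fun j hj => le_tsub_of_add_le_right (mem_fil.1 hx j hj)) hd
      exact ⟨y, mem_fil.2 fun j hj => (le_tsub_iff_right h).1 (mem_fil.1 hy j hj), hyd⟩
    · refine ⟨0, Submodule.zero_mem _, ?_⟩
      rw [map_zero]
      refine (Finsupp.ext fun j => ?_ : x = 0).symm
      by_contra hj
      exact h (le_of_add_le_right (mem_fil.1 hx j hj))

lemma mem_fil_shift {P : GradedComplex K (Fin n →₀ ℕ)} {v c : Fin n →₀ ℕ} {i : ℕ}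
    {x : P.ι i →₀ K} : x ∈ fil K ((P.shift v).deg i) (c + v) ↔ x ∈ fil K (P.deg i) c := by
  simp only [mem_fil]
  exact forall_congr' fun j => imp_congr_right fun _ => add_le_add_iff_right v

lemma le_of_mem_fil_shift {P : GradedComplex K (Fin n →₀ ℕ)} {v c : Fin n →₀ ℕ} {i : ℕ}
    {x : P.ι i →₀ K} (hx : x ∈ fil K ((P.shift v).deg i) c) (h : x ≠ 0) : v ≤ c := by
  obtain ⟨j, hj⟩ := Finsupp.ne_iff.1 h
  exact le_of_add_le_right (mem_fil.1 hx j hj)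

end GradedComplex

variable (K) in
/-- The quotient by the monomial ideal with set of monomials `J` has a free resolution in which
`B i` is the set of degrees of the basis elements in homological degree `i + 1`. -/
def HasResolution (J : Set (Fin n →₀ ℕ)) (B : ℕ → Set (Fin n →₀ ℕ)) : Prop :=
  ∃ P : GradedComplex K (Fin n →₀ ℕ), P.Resolves J ∧ ∀ i, Set.range (P.deg (i + 1)) = B i

open GradedComplex in
-- `J'` is the colon of `J` by `x^v`, so multiplication by `x^v` gives `0 → S/J'(-v) → S/J → S/(J,
-- x^v) → 0`, and the cone of a lift of it resolves the last term.
theorem HasResolution.cone {J J' : Set (Fin n →₀ ℕ)} {B B' C : ℕ → Set (Fin n →₀ ℕ)}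
    (h : HasResolution K J B) (h' : HasResolution K J' B') (v : Fin n →₀ ℕ)
    (hJ : ∀ c, c + v ∈ J ↔ c ∈ J') (hC₀ : C 0 = B 0 ∪ {v})
    (hC : ∀ i, C (i + 1) = B (i + 1) ∪ (fun b => b + v) '' B' i) :
    HasResolution K (J ∪ {c | v ≤ c}) C := by
  obtain ⟨P, hP, hPB⟩ := h
  obtain ⟨Q, hQ, hQB⟩ := h'
  obtain ⟨p₀, hp, hp0, hpJ⟩ := id hP
  obtain ⟨q₀, hq, hq0, hqJ⟩ := id hQ
  obtain ⟨f, f0, hf, hfd⟩ := hP.exists_chainMap (P := Q.shift v) p₀ fun c y hy hd => by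
    have hy0 : y ≠ 0 := by rintro rfl; exact hd (map_zero _)
    obtain ⟨c, rfl⟩ := exists_add_of_le (le_of_mem_fil_shift hy hy0)
    rw [add_comm] at hy ⊢
    exact (hJ c).2 ((hqJ c).1 ⟨y, mem_fil_shift.1 hy, hd⟩)
  have hf_inj : ∀ y, f 0 y = 0 → y = 0 := fun y hy => by
    rw [f0, Finsupp.lmapDomain_apply] at hy
    have hinj : Function.Injective fun _ : (Q.shift v).ι 0 => p₀ :=
      fun a b _ => (hq a).trans (hq b).symm
    exact Finsupp.mapDomain_injective hinj (hy.trans Finsupp.mapDomain_zero.symm)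
  refine ⟨P.cone (Q.shift v) f hf hfd fun c x hx y hy hxy => ?_, ⟨p₀, hp, hp0, fun c => ?_⟩,
    fun i => ?_⟩
  · by_cases hy0 : y = 0
    · exact ⟨0, Submodule.zero_mem _, by rw [hy0, map_zero]⟩
    obtain ⟨c, rfl⟩ := exists_add_of_le (le_of_mem_fil_shift hy hy0)
    rw [add_comm] at hy hx ⊢
    have hc : c ∈ J' := (hJ c).1 ((hpJ _).1 ⟨x, hx, fun h0 => hy0 (hf_inj y (hxy ▸ h0))⟩)
    obtain ⟨z, hz, hzd⟩ := exists_d_eq_of_mem hQ hc y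
    exact ⟨z, mem_fil_shift.2 hz, hzd⟩
  · constructor
    · rintro ⟨y, hy, hd⟩
      have hy := mem_fil_coneDeg.1 hy
      have hd : P.d 0 (coneEquiv P (Q.shift v) 0 y).1 + f 0 (coneEquiv P (Q.shift v) 0 y).2 ≠ 0 :=
        hd
      by_cases h1 : P.d 0 (coneEquiv P (Q.shift v) 0 y).1 = 0
      · refine Or.inr (le_of_mem_fil_shift hy.2 fun h2 => hd ?_)
        rw [h1, h2, map_zero (f 0), add_zero]
      · exact Or.inl ((hpJ c).1 ⟨_, hy.1, h1⟩)
    · rintro (hc | hc)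
      · obtain ⟨y, hy, hd⟩ := (hpJ c).2 hc
        refine ⟨(coneEquiv P (Q.shift v) 0).symm (y, 0), mem_fil_coneDeg.2 ?_, ?_⟩
        · rw [LinearEquiv.apply_symm_apply]
          exact ⟨hy, Submodule.zero_mem _⟩
        · refine ne_of_eq_of_ne (coneD_zero_apply f _) ?_
          rw [LinearEquiv.apply_symm_apply]
          exact ne_of_eq_of_ne ((congrArg (_ + ·) (map_zero (f 0))).trans (add_zero _)) hd
      · refine ⟨(coneEquiv P (Q.shift v) 0).symm (0, Finsupp.single q₀ 1), mem_fil_coneDeg.2 ?_, ?_⟩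
        · rw [LinearEquiv.apply_symm_apply]
          refine ⟨Submodule.zero_mem _, single_mem_fil _ ?_⟩
          change Q.deg 0 q₀ + v ≤ c
          rw [hq0, bot_eq_zero, zero_add]
          exact hc
        · refine ne_of_eq_of_ne (coneD_zero_apply f _) ?_
          rw [LinearEquiv.apply_symm_apply]
          refine ne_of_eq_of_ne ((congrArg (· + _) (map_zero (P.d 0))).trans (zero_add _)) ?_
          exact fun h0 => one_ne_zero (Finsupp.single_eq_zero.1 (hf_inj _ h0))
  · have hr : Set.range (coneDeg P (Q.shift v) (i + 1)) =
        B i ∪ (fun b => b + v) '' Set.range (Q.deg i) := by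
      refine (Set.Sum.elim_range _ _).trans ?_
      rw [hPB, ← Set.range_comp]
      rfl
    refine hr.trans ?_
    cases i with
    | zero =>
      rw [hC₀]
      congr 1
      ext x
      simp only [Set.mem_image, Set.mem_range, Set.mem_singleton_iff]
      constructor
      · rintro ⟨_, ⟨j, rfl⟩, rfl⟩
        rw [hq j, hq0, bot_eq_zero, zero_add]
      · rintro rfl
        exact ⟨_, ⟨q₀, rfl⟩, by rw [hq0, bot_eq_zero, zero_add]⟩
    | succ i => rw [hC, hQB]

variable (K) in
theorem hasResolution_empty : HasResolution (n := n) K ∅ fun _ => ∅ := by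
  obtain ⟨ι, ⟨j₀, hj₀⟩, he⟩ : ∃ ι : ℕ → Type, (∃ j₀ : ι 0, ∀ j, j = j₀) ∧
      ∀ i, IsEmpty (ι (i + 1)) :=
    ⟨fun i => Nat.casesOn i Unit fun _ => Empty, ⟨(), fun _ => rfl⟩,
      fun i => inferInstanceAs (IsEmpty Empty)⟩
  have h0 : ∀ i (x y : ι (i + 1) →₀ K), x = y := fun i x y =>
    Finsupp.ext fun j => (he i).elim j
  let P : GradedComplex K (Fin n →₀ ℕ) :=
    { ι := ι
      finite_ι := fun i => by
        cases i
        · exact @Finite.of_subsingleton _ ⟨fun a b => (hj₀ a).trans (hj₀ b).symm⟩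
        · exact @Finite.of_subsingleton _ ⟨fun a => ((he _).false a).elim⟩
      deg := fun _ _ => 0
      d := fun i => (0 : (ι (i + 1) →₀ K) →ₗ[K] (ι i →₀ K))
      filtered_d := fun i c _ _ => (fil K (fun _ : ι i => (0 : Fin n →₀ ℕ)) c).zero_mem
      d_d := fun _ _ => rfl
      exact_d := fun i _ x _ _ => ⟨0, Submodule.zero_mem _, h0 i _ x⟩ }
  refine ⟨P, ⟨j₀, hj₀, rfl, fun c => ?_⟩, fun i => ?_⟩
  · simp [P]
  · have := he i
    exact Set.range_eq_empty _

variable (K) in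
/-- The Koszul resolution of the ideal generated by a set of variables. -/
theorem hasResolution_variables (A : Finset (Fin n)) :
    HasResolution K {c | ∃ i ∈ A, c i ≠ 0}
      fun i => {b | ∃ σ ⊆ A, σ.card = i + 1 ∧ b = ind σ} := by
  induction A using Finset.induction_on with
  | empty =>
    convert hasResolution_empty (n := n) K using 1
    · simp
    · ext i b
      simp only [Finset.subset_empty, exists_eq_left, Finset.card_empty, Set.mem_ofPred_eq,
        Set.mem_empty_iff_false, iff_false]
      omega
  | insert a A ha ih =>
    have hsplit : ∀ i b, (∃ σ ⊆ insert a A, σ.card = i + 1 ∧ b = ind σ) ↔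
        (∃ σ ⊆ A, σ.card = i + 1 ∧ b = ind σ) ∨
          ∃ σ ⊆ A, σ.card = i ∧ b = ind σ + Finsupp.single a 1 := by
      intro i b
      constructor
      · rintro ⟨σ, hσ, hc, rfl⟩
        by_cases h : a ∈ σ
        · refine Or.inr ⟨σ.erase a, ?_, by rw [Finset.card_erase_of_mem h, hc]; rfl, ?_⟩
          · rwa [← Finset.subset_insert_iff]
          · rw [← ind_singleton, ← ind_union (by simp), Finset.union_comm, ← Finset.insert_eq,
              Finset.insert_erase h]
        · exact Or.inl ⟨σ, (Finset.subset_insert_iff_of_notMem h).1 hσ, hc, rfl⟩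
      · rintro (⟨σ, hσ, hc, rfl⟩ | ⟨σ, hσ, hc, rfl⟩)
        · exact ⟨σ, hσ.trans (Finset.subset_insert _ _), hc, rfl⟩
        · have h : a ∉ σ := fun h => ha (hσ h)
          refine ⟨insert a σ, Finset.insert_subset_insert _ hσ, by
            rw [Finset.card_insert_of_notMem h, hc], ?_⟩
          rw [← ind_singleton, ← ind_union (by simpa using h), Finset.union_comm,
            ← Finset.insert_eq]
    -- As `a ∉ A`, the colon by `x_a` is the same ideal, so the cone joins the complex to its own
    -- shift.
    have h := ih.cone ih (Finsupp.single a 1)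
      (C := fun i => {b | ∃ σ ⊆ insert a A, σ.card = i + 1 ∧ b = ind σ}) ?_ ?_ ?_
    · convert h using 1
      ext c
      rw [← ind_singleton]
      simp [ind_le_iff, or_comm]
    · intro c
      refine exists_congr fun i => and_congr_right fun hi => ?_
      have : a ≠ i := by rintro rfl; exact ha hi
      simp [this]
    · ext b
      rw [Set.mem_ofPred_eq, hsplit]
      simp [or_comm]
    · intro i
      ext b
      rw [Set.mem_ofPred_eq, hsplit]
      refine or_congr Iff.rfl ?_
      constructor
      · rintro ⟨σ, hσ, hc, rfl⟩
        exact ⟨_, ⟨σ, hσ, hc, rfl⟩, rfl⟩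
      · rintro ⟨_, ⟨σ, hσ, hc, rfl⟩, rfl⟩
        exact ⟨σ, hσ, hc, rfl⟩

/-! ### Linear quotients for shifted families. -/

open Classical in
/-- The gaps of a set: the elements of the complement that are less than some element. -/
def gapSet (w : Finset (Fin n)) : Finset (Fin n) :=
  Finset.univ.filter fun i => i ∉ w ∧ ∃ j ∈ w, i < j

lemma mem_gapSet {w : Finset (Fin n)} {i : Fin n} : i ∈ gapSet w ↔ i ∉ w ∧ ∃ j ∈ w, i < j := by
  simp [gapSet]

lemma disjoint_gapSet {w σ : Finset (Fin n)} (h : σ ⊆ gapSet w) : Disjoint σ w :=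
  Finset.disjoint_left.2 fun _ hi => (mem_gapSet.1 (h hi)).1

/-- A family of sets of equal size that is closed under replacing elements by smaller ones. -/
structure IsShifted (𝒢 : Finset (Finset (Fin n))) : Prop where
  card_eq : ∀ v ∈ 𝒢, ∀ w ∈ 𝒢, v.card = w.card
  insert_erase_mem : ∀ w ∈ 𝒢, ∀ i ∉ w, ∀ j ∈ w, i < j → insert i (w.erase j) ∈ 𝒢

/-- The degrees of the basis elements in homological degree `k` of the resolution of the squarefree
stable ideal generated by the monomials with supports in `𝒢`. -/
def stableDegrees (𝒢 : Finset (Finset (Fin n))) (k : ℕ) : Set (Fin n →₀ ℕ) :=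
  {b | ∃ w ∈ 𝒢, ∃ σ ⊆ gapSet w, σ.card = k ∧ b = ind (σ ∪ w)}

lemma toColex_insert_erase_le {w : Finset (Fin n)} {i j : Fin n} (hj : j ∈ w) (hij : i < j) :
    toColex (insert i (w.erase j)) ≤ toColex w := by
  rw [Finset.Colex.toColex_le_toColex]
  intro x hx hxw
  obtain rfl : x = i := by
    by_contra h
    exact hxw (Finset.mem_of_mem_erase ((Finset.mem_insert.1 hx).resolve_left h))
  exact ⟨j, hj, by simp [hij.ne'], hij.le⟩

variable (K) in
-- Induction along the colexicographic order, removing the largest set `a`: the colon of the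
-- remaining ideal by `a` is generated by the variables in the gaps of `a`, whose Koszul complex is
-- coned off.
theorem IsShifted.hasResolution {𝒢 : Finset (Finset (Fin n))} (h𝒢 : IsShifted 𝒢) :
    HasResolution K {c | ∃ w ∈ 𝒢, ind w ≤ c} (stableDegrees 𝒢) := by
  revert h𝒢
  refine Finset.induction_on_max_value (fun w => toColex w) 𝒢 ?_ ?_
  · intro _
    convert hasResolution_empty (n := n) K using 1
    · simp
    · ext i b; simp [stableDegrees]
  · intro a 𝒮 ha hmax ih h𝒢
    have h𝒮 : IsShifted 𝒮 := by
      refine ⟨fun v hv w hw => h𝒢.card_eq v (Finset.mem_insert_of_mem hv) w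
        (Finset.mem_insert_of_mem hw), fun w hw i hi j hj hij => ?_⟩
      refine (Finset.mem_insert.1 (h𝒢.insert_erase_mem w (Finset.mem_insert_of_mem hw) i hi j hj
        hij)).resolve_left fun h => ?_
      have h1 := toColex_insert_erase_le hj hij
      rw [h] at h1
      have h2 := le_antisymm h1 (hmax w hw)
      exact ha ((toColex_inj.1 h2) ▸ hw)
    have hres := (ih h𝒮).cone (hasResolution_variables K (gapSet a)) (ind a)
      (C := stableDegrees (insert a 𝒮)) ?_ ?_ ?_
    · convert hres using 1
      ext c
      simp [or_comm]
    · intro c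
      constructor
      · rintro ⟨w, hw, hwc⟩
        have hwa : w ≠ a := by rintro rfl; exact ha hw
        have hcard := h𝒢.card_eq w (Finset.mem_insert_of_mem hw) a (Finset.mem_insert_self _ _)
        -- Colex comparison puts `i` below an element of `a`, so `i` is a gap of `a`; since `x_i`
        -- divides `c + ind a` but not `ind a`, it divides `c`.
        obtain ⟨i, hi, hia⟩ : ∃ i ∈ w, i ∉ a := by
          by_contra! hsub
          exact hwa (Finset.eq_of_subset_of_card_le hsub hcard.ge)
        obtain ⟨b, hb, -, hib⟩ := Finset.Colex.toColex_le_toColex.1 (hmax w hw) hi hia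
        refine ⟨i, mem_gapSet.2 ⟨hia, b, hb, lt_of_le_of_ne hib ?_⟩, ?_⟩
        · rintro rfl; exact hia hb
        · have := Finsupp.mem_support_iff.1 (ind_le_iff.1 hwc hi)
          simpa [ind_apply, hia] using this
      · rintro ⟨i, hi, hci⟩
        obtain ⟨hia, j, hj, hij⟩ := mem_gapSet.1 hi
        -- Conversely, moving `j` down to the gap `i` gives a member of the family other than `a`.
        refine ⟨insert i (a.erase j), (Finset.mem_insert.1 (h𝒢.insert_erase_mem a
          (Finset.mem_insert_self _ _) i hia j hj hij)).resolve_left fun h => ?_, ?_⟩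
        · exact hia (h ▸ Finset.mem_insert_self _ _)
        · rw [ind_le_iff]
          intro x hx
          rw [Finsupp.mem_support_iff, Finsupp.add_apply]
          rcases Finset.mem_insert.1 hx with rfl | hx
          · omega
          · rw [ind_apply, if_pos (Finset.mem_of_mem_erase hx)]
            omega
    · ext b
      simp [stableDegrees]
    · intro i
      ext b
      constructor
      · rintro ⟨w, hw, σ, hσ, hc, rfl⟩
        rcases Finset.mem_insert.1 hw with rfl | hw
        · exact Or.inr ⟨_, ⟨σ, hσ, hc, rfl⟩, (ind_union (disjoint_gapSet hσ)).symm⟩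
        · exact Or.inl ⟨w, hw, σ, hσ, hc, rfl⟩
      · rintro (⟨w, hw, σ, hσ, hc, rfl⟩ | ⟨_, ⟨σ, hσ, hc, rfl⟩, rfl⟩)
        · exact ⟨w, Finset.mem_insert_of_mem hw, σ, hσ, hc, rfl⟩
        · exact ⟨a, Finset.mem_insert_self _ _, σ, hσ, hc, (ind_union (disjoint_gapSet hσ)).symm⟩

/-! ### Translation between polynomial modules and their multigraded strands. -/

open MvPolynomial

section Multihomogeneous

variable {A B B' : Type*}

/-- The part of multidegree `c` of an element of the free module with basis elements of
multidegrees `s`. -/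
def gradedPart (s : A → Fin n →₀ ℕ) (c : Fin n →₀ ℕ) (Y : A →₀ MvPolynomial (Fin n) K) : A →₀ K :=
  Finsupp.onFinset Y.support (fun l => coeff c (Y l * monomial (s l) 1)) fun l hl => by
    rw [Finsupp.mem_support_iff]
    intro h
    simp [h] at hl

lemma gradedPart_apply (s : A → Fin n →₀ ℕ) (c : Fin n →₀ ℕ)
    (Y : A →₀ MvPolynomial (Fin n) K) (l : A) :
    gradedPart s c Y l = coeff c (Y l * monomial (s l) 1) := rfl

lemma support_gradedPart_subset (s : A → Fin n →₀ ℕ) (c : Fin n →₀ ℕ)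
    (Y : A →₀ MvPolynomial (Fin n) K) : (gradedPart s c Y).support ⊆ Y.support :=
  Finsupp.support_onFinset_subset

lemma gradedPart_zero (s : A → Fin n →₀ ℕ) (c : Fin n →₀ ℕ) :
    gradedPart s c (0 : A →₀ MvPolynomial (Fin n) K) = 0 := by
  ext l; simp [gradedPart_apply]

lemma gradedPart_mem_fil (s : A → Fin n →₀ ℕ) (c : Fin n →₀ ℕ)
    (Y : A →₀ MvPolynomial (Fin n) K) : gradedPart s c Y ∈ fil K s c := by
  rw [mem_fil]
  intro l hl
  rw [gradedPart_apply, coeff_mul_monomial'] at hl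
  by_contra h
  exact hl (if_neg h)

/-- The element of multidegree `c` with given coefficients. -/
def homogElem (s : A → Fin n →₀ ℕ) (c : Fin n →₀ ℕ) (x : A →₀ K) :
    A →₀ MvPolynomial (Fin n) K :=
  Finsupp.onFinset x.support (fun l => monomial (c - s l) (x l)) fun l hl => by
    rw [Finsupp.mem_support_iff]
    intro h
    simp [h] at hl

lemma homogElem_apply (s : A → Fin n →₀ ℕ) (c : Fin n →₀ ℕ) (x : A →₀ K) (l : A) :
    homogElem s c x l = monomial (c - s l) (x l) := rfl

lemma support_homogElem_subset (s : A → Fin n →₀ ℕ) (c : Fin n →₀ ℕ) (x : A →₀ K) :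
    (homogElem s c x).support ⊆ x.support :=
  Finsupp.support_onFinset_subset

lemma homogElem_apply_mul {s : A → Fin n →₀ ℕ} {c : Fin n →₀ ℕ} {x : A →₀ K}
    (hx : x ∈ fil K s c) (l : A) :
    homogElem s c x l * monomial (s l) 1 = monomial c (x l) := by
  rw [homogElem_apply]
  by_cases h : x l = 0
  · simp [h]
  · rw [monomial_mul, mul_one, tsub_add_cancel_of_le (mem_fil.1 hx l h)]

lemma gradedPart_homogElem {s : A → Fin n →₀ ℕ} {c : Fin n →₀ ℕ} {x : A →₀ K}
    (hx : x ∈ fil K s c) : gradedPart s c (homogElem s c x) = x := by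
  ext l
  rw [gradedPart_apply, homogElem_apply_mul hx, coeff_monomial, if_pos rfl]

lemma mul_monomial_one_injective (c : Fin n →₀ ℕ) :
    Function.Injective fun p : MvPolynomial (Fin n) K => p * monomial c 1 :=
  mul_left_injective₀ (by simp)

lemma ext_gradedPart (s : A → Fin n →₀ ℕ) {Y Z : A →₀ MvPolynomial (Fin n) K}
    (h : ∀ c, gradedPart s c Y = gradedPart s c Z) : Y = Z := by
  ext1 l
  refine mul_monomial_one_injective (s l) (MvPolynomial.ext _ _ fun c => ?_)
  exact DFunLike.congr_fun (h c) l

lemma eq_sum_homogElem (s : A → Fin n →₀ ℕ) (Y : A →₀ MvPolynomial (Fin n) K) :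
    ∃ T : Finset (Fin n →₀ ℕ), Y = ∑ c ∈ T, homogElem s c (gradedPart s c Y) := by
  classical
  refine ⟨Y.support.biUnion fun l => (Y l * monomial (s l) 1).support, ?_⟩
  ext1 l
  apply mul_monomial_one_injective (s l)
  simp only [Finsupp.finsetSum_apply, Finset.sum_mul,
    homogElem_apply_mul (gradedPart_mem_fil s _ Y), gradedPart_apply]
  by_cases hl : Y l = 0
  · simp [hl]
  conv_lhs => rw [MvPolynomial.as_sum (Y l * monomial (s l) 1)]
  refine Finset.sum_subset (fun c hc => Finset.mem_biUnion.2 ⟨l, Finsupp.mem_support_iff.2 hl, hc⟩)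
    fun c _ hc => ?_
  rw [notMem_support_iff.1 hc, map_zero]

/-- The map `d` between free modules is multihomogeneous of degree `0` with coefficients `D`. -/
def IsMultihom (s : A → Fin n →₀ ℕ) (t : B → Fin n →₀ ℕ)
    (d : (A →₀ MvPolynomial (Fin n) K) →ₗ[MvPolynomial (Fin n) K] (B →₀ MvPolynomial (Fin n) K))
    (D : (A →₀ K) →ₗ[K] (B →₀ K)) : Prop :=
  ∀ j l, d (Finsupp.single j 1) l * monomial (t l) 1 = monomial (s j) (D (Finsupp.single j 1) l)

variable {s : A → Fin n →₀ ℕ} {t : B → Fin n →₀ ℕ} {r : B' → Fin n →₀ ℕ}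
  {d : (A →₀ MvPolynomial (Fin n) K) →ₗ[MvPolynomial (Fin n) K] (B →₀ MvPolynomial (Fin n) K)}
  {d' : (B →₀ MvPolynomial (Fin n) K) →ₗ[MvPolynomial (Fin n) K] (B' →₀ MvPolynomial (Fin n) K)}
  {D : (A →₀ K) →ₗ[K] (B →₀ K)} {D' : (B →₀ K) →ₗ[K] (B' →₀ K)}

lemma IsMultihom.mul_monomial (h : IsMultihom s t d D) (Y : A →₀ MvPolynomial (Fin n) K) (l : B) :
    d Y l * monomial (t l) 1 =
      Y.sum fun j a => a * monomial (s j) 1 * C (D (Finsupp.single j 1) l) := by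
  rw [apply_eq_sum_single, Finsupp.sum, Finset.sum_mul]
  refine Finset.sum_congr rfl fun j _ => ?_
  beta_reduce
  rw [mul_assoc, h j l, mul_assoc, mul_comm (monomial _ _) (C _), C_mul_monomial,
    mul_one]

lemma IsMultihom.gradedPart_apply (h : IsMultihom s t d D) (c : Fin n →₀ ℕ)
    (Y : A →₀ MvPolynomial (Fin n) K) : gradedPart t c (d Y) = D (gradedPart s c Y) := by
  ext l
  rw [SquarefreeBorel.gradedPart_apply, h.mul_monomial, apply_eq_sum_single, Finsupp.sum, coeff_sum,
    Finsupp.sum_of_support_subset _ (support_gradedPart_subset s c Y) _ (by simp)]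
  refine Finset.sum_congr rfl fun j _ => ?_
  rw [mul_comm _ (C _), coeff_C_mul, SquarefreeBorel.gradedPart_apply, mul_comm]

lemma IsMultihom.isFiltered (h : IsMultihom s t d D) : IsFiltered s t D := by
  refine isFiltered_of_single fun j => mem_fil.2 fun l hl => ?_
  have h1 := congrArg (coeff (s j)) (h j l)
  rw [coeff_monomial, if_pos rfl, coeff_mul_monomial'] at h1
  by_contra hle
  rw [if_neg hle] at h1
  exact hl h1.symm

lemma IsMultihom.apply_homogElem (h : IsMultihom s t d D) {c : Fin n →₀ ℕ} {x : A →₀ K}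
    (hx : x ∈ fil K s c) : d (homogElem s c x) = homogElem t c (D x) := by
  ext1 l
  apply mul_monomial_one_injective (t l)
  simp only
  rw [h.mul_monomial, homogElem_apply_mul (h.isFiltered _ _ hx), apply_eq_sum_single,
    Finsupp.sum_of_support_subset _ (support_homogElem_subset s c x) _ (by simp),
    Finsupp.sum, map_sum]
  refine Finset.sum_congr rfl fun j _ => ?_
  rw [homogElem_apply_mul hx, mul_comm, C_mul_monomial, mul_comm]

lemma exists_isMultihom
    (h : ∀ j l, ∃ c : K, d (Finsupp.single j 1) l * monomial (t l) 1 = monomial (s j) c) :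
    ∃ D : (A →₀ K) →ₗ[K] (B →₀ K), IsMultihom s t d D := by
  choose c hc using h
  refine ⟨Finsupp.linearCombination K fun j => Finsupp.onFinset (d (Finsupp.single j 1)).support
    (c j) fun l hl => ?_, fun j l => ?_⟩
  · rw [Finsupp.mem_support_iff]
    intro h
    have h1 := hc j l
    rw [h, zero_mul, eq_comm, monomial_eq_zero] at h1
    exact hl h1
  · simp [hc]

lemma IsFiltered.exists_isMultihom (h : IsFiltered s t D) :
    ∃ d : (A →₀ MvPolynomial (Fin n) K) →ₗ[MvPolynomial (Fin n) K]
      (B →₀ MvPolynomial (Fin n) K), IsMultihom s t d D := by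
  refine ⟨Finsupp.linearCombination _ fun j => homogElem t (s j) (D (Finsupp.single j 1)),
    fun j l => ?_⟩
  rw [Finsupp.linearCombination_single, one_smul,
    homogElem_apply_mul (h _ _ (single_mem_fil 1 le_rfl))]

/-- Multihomogeneous maps act separately on each multidegree, and an element is the finite sum of
its homogeneous parts; exactness can thus be tested degree by degree. -/
theorem IsMultihom.exact_iff (h : IsMultihom s t d D) (h' : IsMultihom t r d' D') :
    Function.Exact d d' ↔ (∀ x, D' (D x) = 0) ∧
      ∀ c, ∀ x ∈ fil K t c, D' x = 0 → ∃ y ∈ fil K s c, D y = x := by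
  constructor
  · refine fun hd => ⟨fun x => ?_, fun c x hx h0 => ?_⟩
    · have : D' ∘ₗ D = 0 := by
        ext j : 2
        have hj : Finsupp.single j (1 : K) ∈ fil K s (s j) := single_mem_fil 1 le_rfl
        have h1 := hd.apply_apply_eq_zero (homogElem s (s j) (Finsupp.single j 1))
        have h2 := gradedPart_homogElem (h'.isFiltered _ _ (h.isFiltered _ _ hj))
        rw [h.apply_homogElem hj, h'.apply_homogElem (h.isFiltered _ _ hj)] at h1
        rw [h1, gradedPart_zero] at h2
        simpa using h2.symm
      exact LinearMap.congr_fun this x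
    · obtain ⟨Y, hY⟩ := (hd (homogElem t c x)).1 (by
        rw [h'.apply_homogElem hx, h0]
        ext l; simp [homogElem_apply])
      refine ⟨gradedPart s c Y, gradedPart_mem_fil _ _ _, ?_⟩
      rw [← h.gradedPart_apply, hY, gradedPart_homogElem hx]
  · rintro ⟨hDD, hD⟩ Y
    constructor
    · intro hY
      obtain ⟨T, hT⟩ := eq_sum_homogElem t Y
      have hc : ∀ c, ∃ y ∈ fil K s c, D y = gradedPart t c Y := fun c =>
        hD c _ (gradedPart_mem_fil _ _ _) (by rw [← h'.gradedPart_apply, hY, gradedPart_zero])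
      choose y hy hyD using hc
      refine ⟨∑ c ∈ T, homogElem s c (y c), ?_⟩
      conv_rhs => rw [hT]
      rw [map_sum]
      exact Finset.sum_congr rfl fun c _ => by rw [h.apply_homogElem (hy c), hyD]
    · rintro ⟨Z, rfl⟩
      refine ext_gradedPart r fun c => ?_
      rw [h'.gradedPart_apply, h.gradedPart_apply, hDD, gradedPart_zero]

end Multihomogeneous

/-! ### Homological shift ideals from a linear resolution. -/

namespace MinMultigradedResolution

variable {I : Ideal (MvPolynomial (Fin n) K)} (F : MinMultigradedResolution I)

/-- The index sets of the bases of the augmented resolution. -/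
abbrev augι : ℕ → Type
  | 0 => Unit
  | i + 1 => F.ι i

/-- The shifts of the augmented resolution. -/
def augShift : ∀ i, F.augι i → (Fin n →₀ ℕ)
  | 0 => fun _ => 0
  | i + 1 => F.shift i

/-- The differentials of the augmented resolution. -/
def augD : ∀ i, (F.augι (i + 1) →₀ MvPolynomial (Fin n) K) →ₗ[MvPolynomial (Fin n) K]
    (F.augι i →₀ MvPolynomial (Fin n) K)
  | 0 => (Finsupp.uniqueLinearEquiv _ _ ()).symm.toLinearMap ∘ₗ F.ε
  | i + 1 => F.d i

lemma augD_zero_apply (Y : F.ι 0 →₀ MvPolynomial (Fin n) K) (l : Unit) :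
    F.augD 0 Y l = F.ε Y := by
  simp [augD, Finsupp.uniqueLinearEquiv]

lemma augD_zero_eq_zero (Y : F.ι 0 →₀ MvPolynomial (Fin n) K) :
    F.augD 0 Y = 0 ↔ F.ε Y = 0 := by
  simp [augD]

lemma exact_augD (i : ℕ) : Function.Exact (F.augD (i + 1)) (F.augD i) := by
  cases i with
  | zero => exact fun Y => (F.augD_zero_eq_zero Y).trans (F.exact_ε Y)
  | succ i => exact F.exact_d i

lemma exists_isMultihom_augD (i : ℕ) : ∃ D, IsMultihom (F.augShift (i + 1)) (F.augShift i)
    (F.augD i) D := by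
  refine exists_isMultihom fun j l => ?_
  cases i with
  | zero =>
    obtain ⟨c, hc⟩ := F.homogeneous_ε j
    refine ⟨c, ?_⟩
    rw [augD_zero_apply, hc]
    simp [augShift]
  | succ i => exact F.homogeneous_d i j l

theorem exists_gradedComplex : ∃ P : GradedComplex K (Fin n →₀ ℕ),
    P.Resolves {c | monomial c 1 ∈ I} ∧ P.IsMinimal ∧
      ∀ i, Set.range (P.deg (i + 1)) = Set.range (F.shift i) := by
  choose D hD using F.exists_isMultihom_augD
  refine ⟨⟨F.augι, fun i => ?_, F.augShift, D, fun i => (hD i).isFiltered,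
    fun i => (((hD (i + 1)).exact_iff (hD i)).1 (F.exact_augD i)).1,
    fun i => (((hD (i + 1)).exact_iff (hD i)).1 (F.exact_augD i)).2⟩,
    ⟨(), fun _ => rfl, rfl, fun c => ⟨?_, fun hc => ?_⟩⟩, fun i j l hne heq => ?_, fun i => rfl⟩
  · cases i
    · exact inferInstanceAs (Finite Unit)
    · exact F.finite_ι _
  · rintro ⟨y, hy, hne⟩
    have h1 := F.augD_zero_apply (homogElem (F.augShift 1) c y) ()
    rw [(hD 0).apply_homogElem hy, homogElem_apply] at h1
    have h2 : F.ε (homogElem (F.augShift 1) c y) ∈ LinearMap.range F.ε :=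
      LinearMap.mem_range_self _ _
    rw [F.range_ε, ← h1] at h2
    have hne' : D 0 y () ≠ 0 := fun h0 => hne (Finsupp.ext fun _ => h0)
    have h3 := I.mul_mem_left (C (D 0 y ())⁻¹) h2
    rw [C_mul_monomial, inv_mul_cancel₀ hne'] at h3
    simpa [augShift] using h3
  · have hc' : monomial c (1 : K) ∈ LinearMap.range F.ε := by rw [F.range_ε]; exact hc
    obtain ⟨Y, hY⟩ := hc'
    refine ⟨gradedPart _ c Y, gradedPart_mem_fil _ _ _, fun h0 => ?_⟩
    have h1 := DFunLike.congr_fun ((hD 0).gradedPart_apply c Y) ()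
    have h2 : D 0 (gradedPart (F.augShift (0 + 1)) c Y) = 0 := h0
    rw [gradedPart_apply, augD_zero_apply, hY, h2] at h1
    simp [augShift] at h1
  -- Between equal shifts a matrix entry is a constant, which `F.minimal` forces to be zero.
  · have h1 := hD (i + 1) j l
    have h2 : F.augShift (i + 1) l = F.augShift (i + 2) j := heq
    rw [← h2, ← mul_one (D (i + 1) _ l), ← C_mul_monomial] at h1
    have h3 := mul_monomial_one_injective _ h1
    have h4 : constantCoeff (F.augD (i + 1) (Finsupp.single j 1) l) = 0 := F.minimal i j l
    rw [h3, constantCoeff_C] at h4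
    exact hne h4

end MinMultigradedResolution

namespace GradedComplex

/-- `homologicalShift` ranges over actual resolutions; this exhibits one, so that every degree of
`P` does occur. -/
theorem Resolves.exists_minMultigradedResolution {P : GradedComplex K (Fin n →₀ ℕ)}
    {I : Ideal (MvPolynomial (Fin n) K)} {J : Set (Fin n →₀ ℕ)} (hP : P.Resolves J)
    (hmin : P.IsMinimal) (hI : ∀ p, p ∈ I ↔ ∀ m ∈ p.support, m ∈ J) :
    ∃ F : MinMultigradedResolution I,
      ∀ i, Set.range (F.shift i) = Set.range (P.deg (i + 1)) := by
  obtain ⟨p₀, hp, hp0, hpJ⟩ := hP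
  choose d hd using fun i => (P.filtered_d i).exists_isMultihom
  have hexact : ∀ i, Function.Exact (d (i + 1)) (d i) := fun i =>
    ((hd (i + 1)).exact_iff (hd i)).2 ⟨P.d_d i, P.exact_d i⟩
  have hε : ∀ Y, d 0 Y p₀ = 0 ↔ d 0 Y = 0 := fun Y =>
    ⟨fun h => Finsupp.ext fun j => by rw [hp j, h]; rfl, fun h => by rw [h]; rfl⟩
  refine ⟨⟨fun i => P.ι (i + 1), fun i => P.finite_ι _, fun i => P.deg (i + 1),
    fun i => d (i + 1), Finsupp.lapply p₀ ∘ₗ d 0, ?_, fun Y => (hε Y).trans (hexact 0 Y),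
    fun i => hexact (i + 1), fun j => ⟨P.d 0 (Finsupp.single j 1) p₀, ?_⟩,
    fun i j l => ⟨_, hd (i + 1) j l⟩, fun i j l => ?_⟩, fun i => rfl⟩
  · ext p
    rw [hI, LinearMap.mem_range]
    constructor
    · rintro ⟨Y, rfl⟩ m hm
      refine (hpJ m).1 ⟨gradedPart _ m Y, gradedPart_mem_fil _ _ _, fun h0 => ?_⟩
      have h1 := DFunLike.congr_fun ((hd 0).gradedPart_apply m Y) p₀
      rw [h0, gradedPart_apply, hp0] at h1
      refine mem_support_iff.1 hm ?_
      simpa [bot_eq_zero] using h1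
    · intro hp'
      suffices p ∈ LinearMap.range (Finsupp.lapply p₀ ∘ₗ d 0) from this
      rw [p.as_sum]
      refine Submodule.sum_mem _ fun m hm => ?_
      obtain ⟨y, hy, hy0⟩ := (hpJ m).2 (hp' m hm)
      have hy1 : P.d 0 y p₀ ≠ 0 := fun h => hy0 (Finsupp.ext fun j => by rw [hp j, h]; rfl)
      refine ⟨(C (coeff m p / P.d 0 y p₀) : MvPolynomial (Fin n) K) • homogElem (P.deg 1) m y, ?_⟩
      rw [map_smul, LinearMap.comp_apply, Finsupp.lapply_apply, (hd 0).apply_homogElem hy,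
        homogElem_apply, hp0, bot_eq_zero, tsub_zero, smul_eq_mul, C_mul_monomial,
        div_mul_cancel₀ _ hy1]
  · have := hd 0 j p₀
    rw [hp0] at this
    simpa [bot_eq_zero] using this
  · change coeff 0 _ = 0
    have h1 := congrArg (coeff (P.deg (i + 1) l)) (hd (i + 1) j l)
    rw [coeff_mul_monomial', if_pos le_rfl, tsub_self, mul_one, coeff_monomial] at h1
    rw [h1, ite_eq_right_iff]
    intro heq
    by_contra hne
    exact hmin i j l hne heq.symm

end GradedComplex

/-- Total degree `D + i` in step `i` forbids equal degrees in consecutive steps, so the resolution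
is minimal. Comparison with it bounds the shifts of any other minimal resolution; realizing it gives
the converse. -/
theorem HasResolution.homologicalShift_eq {I : Ideal (MvPolynomial (Fin n) K)}
    {J : Set (Fin n →₀ ℕ)} {B : ℕ → Set (Fin n →₀ ℕ)} (h : HasResolution K J B)
    (hI : ∀ p, p ∈ I ↔ ∀ m ∈ p.support, m ∈ J) {D : ℕ} (hdeg : ∀ i, ∀ b ∈ B i, b.degree = D + i)
    (k : ℕ) : homologicalShift k I = Ideal.span ((fun b => monomial b (1 : K)) '' B k) := by
  obtain ⟨P, hP, hPB⟩ := h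
  have hmin : P.IsMinimal := fun i j l _ heq => by
    have h1 := hdeg i _ (hPB i ▸ Set.mem_range_self l)
    have h2 := hdeg (i + 1) _ (hPB (i + 1) ▸ Set.mem_range_self j)
    have h3 := h1.symm.trans ((congrArg Finsupp.degree heq).trans h2)
    omega
  have hJ : {c | monomial c 1 ∈ I} = J := by
    ext c
    change monomial c (1 : K) ∈ I ↔ _
    rw [hI]
    simp
  rw [homologicalShift]
  congr 1
  ext p
  constructor
  · rintro ⟨F, j, rfl⟩
    obtain ⟨Q, hQ, hQmin, hQdeg⟩ := F.exists_gradedComplex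
    obtain ⟨j', hj'⟩ : F.shift k j ∈ Set.range (Q.deg (k + 1)) := hQdeg k ▸ Set.mem_range_self j
    rw [hJ] at hQ
    obtain ⟨l, hl⟩ := hQ.exists_deg_eq hP hQmin k j'
    refine ⟨_, ?_, rfl⟩
    rw [← hj', ← hl, ← hPB]
    exact Set.mem_range_self l
  · rintro ⟨b, hb, rfl⟩
    obtain ⟨F, hF⟩ := hP.exists_minMultigradedResolution hmin hI
    rw [← hPB, ← hF] at hb
    obtain ⟨j, rfl⟩ := hb
    exact ⟨F, j, rfl⟩

/-! ### Hilbert series of squarefree monomial ideals. -/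

/-- `J` is the squarefree monomial ideal generated by the monomials whose supports satisfy `p`,
where `p` is closed under taking larger sets. -/
structure IsSquarefreeIdeal (J : Ideal (MvPolynomial (Fin n) K)) (p : Finset (Fin n) → Prop) :
    Prop where
  mem_iff : ∀ q, q ∈ J ↔ ∀ m ∈ q.support, p m.support
  mono : ∀ F G, F ⊆ G → p F → p G

section HilbertFunction

open Classical in
/-- The monomials of degree `t` with supports that do not satisfy `p`. -/
def standardMonomials (p : Finset (Fin n) → Prop) (t : ℕ) : Finset (Fin n →₀ ℕ) :=
  (Finset.finsuppAntidiag Finset.univ t).filter fun m => ¬p m.support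

lemma mem_standardMonomials {p : Finset (Fin n) → Prop} {t : ℕ} {m : Fin n →₀ ℕ} :
    m ∈ standardMonomials p t ↔ m.degree = t ∧ ¬p m.support := by
  simp [standardMonomials, Finset.mem_finsuppAntidiag, Finsupp.degree_eq_sum]

theorem IsSquarefreeIdeal.hilbertFunction_eq {J : Ideal (MvPolynomial (Fin n) K)}
    {p : Finset (Fin n) → Prop} (h : IsSquarefreeIdeal J p) (t : ℕ) :
    hilbertFunction J t = (standardMonomials p t).card := by
  classical
  let ψ : (standardMonomials p t →₀ K) →ₗ[K] MvPolynomial (Fin n) K :=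
    Finsupp.linearCombination K fun m => monomial m.1 1
  have hψ : ∀ x m, coeff m.1 (ψ x) = x m := by
    intro x m
    simp only [ψ, Finsupp.linearCombination_apply, Finsupp.sum, coeff_sum, coeff_smul,
      coeff_monomial, smul_eq_mul, mul_ite, mul_one, mul_zero, Subtype.coe_inj]
    rw [Finset.sum_ite_eq']
    simp only [Finsupp.mem_support_iff, ite_eq_left_iff, not_not]
    exact fun h => h.symm
  let φ := (Ideal.Quotient.mkₐ K J).toLinearMap ∘ₗ ψ
  have hinj : Function.Injective φ := by
    rw [← LinearMap.ker_eq_bot, LinearMap.ker_eq_bot']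
    intro x hx
    have hmem : ψ x ∈ J := Ideal.Quotient.eq_zero_iff_mem.1 hx
    ext m
    rw [← hψ]
    by_contra hne
    exact (mem_standardMonomials.1 m.2).2 ((h.mem_iff _).1 hmem m (mem_support_iff.2 hne))
  have hrange : (homogeneousSubmodule (Fin n) K t).map (Ideal.Quotient.mkₐ K J).toLinearMap =
      LinearMap.range φ := by
    apply le_antisymm
    · rintro _ ⟨q, hq, rfl⟩
      rw [MvPolynomial.as_sum q, map_sum]
      refine Submodule.sum_mem _ fun m hm => ?_
      have hdeg : m.degree = t := by
        by_contra hne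
        exact mem_support_iff.1 hm (IsHomogeneous.coeff_eq_zero hq hne)
      by_cases hp : p m.support
      · have hJ : monomial m (coeff m q) ∈ J := by
          refine (h.mem_iff _).2 fun m' hm' => ?_
          rwa [Finset.mem_singleton.1 (support_monomial_subset hm')]
        have h0 : (Ideal.Quotient.mkₐ K J).toLinearMap (monomial m (coeff m q)) = 0 :=
          Ideal.Quotient.eq_zero_iff_mem.2 hJ
        rw [h0]
        exact Submodule.zero_mem _
      · refine ⟨Finsupp.single ⟨m, mem_standardMonomials.2 ⟨hdeg, hp⟩⟩ (coeff m q), ?_⟩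
        simp [φ, ψ, smul_monomial]
    · rintro _ ⟨x, rfl⟩
      refine ⟨ψ x, ?_, rfl⟩
      refine Submodule.sum_mem _ fun m _ => Submodule.smul_mem _ _ ?_
      exact isHomogeneous_monomial _ (mem_standardMonomials.1 m.2).1
  rw [hilbertFunction, hrange, LinearMap.finrank_range_of_inj hinj, Module.finrank_finsupp_self,
    Fintype.card_coe]

/-- The power series `z / (1 - z)`. -/
def geomSeries : PowerSeries ℤ := PowerSeries.mk fun t => if t = 0 then 0 else 1

lemma geomSeries_mul_one_sub : geomSeries * (1 - PowerSeries.X) = PowerSeries.X := by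
  have h : geomSeries = PowerSeries.mk 1 - 1 := by
    ext t
    by_cases ht : t = 0 <;> simp [geomSeries, PowerSeries.coeff_one, ht]
  rw [h, sub_mul, PowerSeries.mk_one_mul_one_sub_eq_one]
  ring

lemma geomSeries_pow_mul_one_sub_pow {a D : ℕ} (h : a ≤ D) :
    geomSeries ^ a * (1 - PowerSeries.X) ^ D = PowerSeries.X ^ a * (1 - PowerSeries.X) ^ (D - a) := by
  obtain ⟨b, rfl⟩ := Nat.exists_eq_add_of_le h
  rw [Nat.add_sub_cancel_left, pow_add, ← mul_assoc, ← mul_pow, geomSeries_mul_one_sub]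

open Classical in
-- Each variable of `F` occurs with a positive exponent and so contributes a factor `z / (1 - z)`.
lemma coeff_geomSeries_pow (F : Finset (Fin n)) (t : ℕ) :
    PowerSeries.coeff t (geomSeries ^ F.card) =
      ((Finset.finsuppAntidiag Finset.univ t).filter fun m => m.support = F).card := by
  rw [← Finset.prod_const, PowerSeries.coeff_prod]
  simp only [geomSeries, PowerSeries.coeff_mk]
  rw [Finset.card_eq_sum_ones, Nat.cast_sum, Finset.sum_filter]
  have hsub : Finset.finsuppAntidiag F t ⊆ Finset.finsuppAntidiag Finset.univ t :=
    Finset.finsuppAntidiag_mono (Finset.subset_univ _) t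
  refine (Finset.sum_congr rfl fun m hm => ?_).trans (Finset.sum_subset hsub fun m hm hmF => ?_)
  · by_cases hs : m.support = F
    · rw [if_pos hs]
      refine (Finset.prod_eq_one fun i hi => if_neg ?_).trans (by simp)
      rwa [← hs, Finsupp.mem_support_iff] at hi
    · rw [if_neg hs]
      obtain ⟨i, hi, him⟩ : ∃ i ∈ F, i ∉ m.support := by
        by_contra! hsub
        exact hs ((Finset.mem_finsuppAntidiag.1 hm).2.antisymm hsub)
      exact Finset.prod_eq_zero hi (if_pos (Finsupp.notMem_support_iff.1 him))
  · refine if_neg fun hs => hmF (Finset.mem_finsuppAntidiag.2 ⟨?_, hs.le⟩)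
    rw [← (Finset.mem_finsuppAntidiag.1 hm).1]
    refine Finset.sum_subset (Finset.subset_univ _) fun i _ hi => ?_
    rwa [← hs, Finsupp.notMem_support_iff] at hi

open Classical in
/-- The faces of the simplicial complex of a squarefree ideal. -/
def faces (p : Finset (Fin n) → Prop) : Finset (Finset (Fin n)) :=
  Finset.univ.filter fun F => ¬p F

lemma mem_faces {p : Finset (Fin n) → Prop} {F : Finset (Fin n)} : F ∈ faces p ↔ ¬p F := by
  simp [faces]

theorem IsSquarefreeIdeal.hilbertSeries_eq {J : Ideal (MvPolynomial (Fin n) K)}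
    {p : Finset (Fin n) → Prop} (h : IsSquarefreeIdeal J p) :
    hilbertSeries J = ∑ F ∈ faces p, geomSeries ^ F.card := by
  classical
  ext t
  rw [hilbertSeries, PowerSeries.coeff_mk, h.hilbertFunction_eq, map_sum]
  simp only [coeff_geomSeries_pow]
  rw [← Nat.cast_sum]
  congr 1
  rw [Finset.card_eq_sum_card_fiberwise (f := Finsupp.support) (t := faces p)]
  · refine Finset.sum_congr rfl fun F hF => congrArg Finset.card (Finset.ext fun m => ?_)
    simp only [standardMonomials, Finset.mem_filter, and_assoc]
    refine and_congr_right fun _ => ⟨fun h => h.2, fun h => ⟨?_, h⟩⟩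
    rw [h]
    exact mem_faces.1 hF
  · exact fun m hm => mem_faces.2 (mem_standardMonomials.1 hm).2

end HilbertFunction

/-! ### Krull dimension and multiplicity of squarefree monomial quotients. -/

section KrullDimension

open Classical in
/-- The substitution of `0` for the variables outside of `F`. -/
def restrict (F : Finset (Fin n)) : MvPolynomial (Fin n) K →ₐ[K] MvPolynomial F K :=
  aeval fun i => if h : i ∈ F then X ⟨i, h⟩ else 0

lemma restrict_rename (F : Finset (Fin n)) (q : MvPolynomial F K) :
    restrict F (rename Subtype.val q) = q := by
  rw [restrict, aeval_rename]
  have : ((fun i => if h : i ∈ F then X ⟨i, h⟩ else 0) ∘ Subtype.val :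
      F → MvPolynomial F K) = X := by
    ext1 i; simp
  rw [this, aeval_X_left_apply]

lemma ringKrullDim_mvPolynomial (F : Finset (Fin n)) :
    ringKrullDim (MvPolynomial F K) = (F.card : ℕ) := by
  rw [MvPolynomial.ringKrullDim_of_isNoetherianRing, ringKrullDim_eq_zero_of_field]
  simp

lemma ker_restrict_le {F : Finset (Fin n)} {P : Ideal (MvPolynomial (Fin n) K)}
    (hP : ∀ i ∉ F, X i ∈ P) : RingHom.ker (restrict (K := K) F) ≤ P := by
  intro q hq
  have h : (Ideal.Quotient.mkₐ K P).comp ((rename Subtype.val).comp (restrict F)) =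
      Ideal.Quotient.mkₐ K P := by
    ext i
    by_cases hi : i ∈ F
    · simp [restrict, hi]
    · simpa [restrict, hi] using (Ideal.Quotient.eq_zero_iff_mem.2 (hP i hi)).symm
  have h1 := DFunLike.congr_fun h q
  simp only [AlgHom.comp_apply, RingHom.mem_ker.1 hq, map_zero] at h1
  exact Ideal.Quotient.eq_zero_iff_mem.1 h1.symm

lemma IsSquarefreeIdeal.le_ker_restrict {J : Ideal (MvPolynomial (Fin n) K)}
    {p : Finset (Fin n) → Prop} (h : IsSquarefreeIdeal J p) {F : Finset (Fin n)} (hF : ¬p F) :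
    J ≤ RingHom.ker (restrict (K := K) F) := by
  intro q hq
  rw [RingHom.mem_ker, MvPolynomial.as_sum q, map_sum]
  refine Finset.sum_eq_zero fun m hm => ?_
  obtain ⟨i, him, hiF⟩ : ∃ i ∈ m.support, i ∉ F := by
    by_contra! hsub
    exact hF (h.mono _ _ hsub ((h.mem_iff q).1 hq m hm))
  rw [restrict, aeval_monomial, Finsupp.prod, Finset.prod_eq_zero him, mul_zero]
  rw [dif_neg hiF, zero_pow (Finsupp.mem_support_iff.1 him)]

/-- Take the variables outside `P`: were their set not a face, their product would lie in `J ≤ P`,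
against primality. -/
lemma IsSquarefreeIdeal.exists_face {J : Ideal (MvPolynomial (Fin n) K)}
    {p : Finset (Fin n) → Prop} (h : IsSquarefreeIdeal J p) {P : Ideal (MvPolynomial (Fin n) K)}
    (hP : P.IsPrime) (hJ : J ≤ P) : ∃ F, ¬p F ∧ ∀ i ∉ F, X i ∈ P := by
  classical
  refine ⟨Finset.univ.filter fun i => X i ∉ P, fun hp => ?_, fun i hi => by simpa using hi⟩
  set F : Finset (Fin n) := Finset.univ.filter fun i => X i ∉ P
  have hmon : monomial (ind F) (1 : K) ∈ J := by
    refine (h.mem_iff _).2 fun m hm => ?_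
    rw [Finset.mem_singleton.1 (support_monomial_subset hm), support_ind]
    exact hp
  have hprod : monomial (ind F) (1 : K) = ∏ i ∈ F, X i := by
    rw [monomial_eq, map_one, one_mul, Finsupp.prod, support_ind]
    exact Finset.prod_congr rfl fun i hi => by rw [ind_apply, if_pos hi, pow_one]
  rw [hprod] at hmon
  obtain ⟨i, hi, hiP⟩ := (hP.prod_mem_iff).1 (hJ hmon)
  exact (Finset.mem_filter.1 hi).2 hiP

/-- The bottom prime of a chain over `J` contains all variables outside some face `F`, so the chain
lives over a polynomial ring in `|F|` variables. Conversely `S/J` surjects onto such a ring for each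
face. -/
theorem IsSquarefreeIdeal.ringKrullDim_eq {J : Ideal (MvPolynomial (Fin n) K)}
    {p : Finset (Fin n) → Prop} (h : IsSquarefreeIdeal J p) {D : ℕ}
    (hD : ∃ F, ¬p F ∧ F.card = D) (hmax : ∀ F, ¬p F → F.card ≤ D) :
    ringKrullDim (MvPolynomial (Fin n) K ⧸ J) = D := by
  apply le_antisymm
  · rw [ringKrullDim_quotient]
    refine iSup_le fun s => ?_
    obtain ⟨F, hF, hX⟩ := h.exists_face s.head.1.isPrime s.head.2
    have hker := ker_restrict_le hX
    have hs : ∀ i, (s i).1 ∈ PrimeSpectrum.zeroLocus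
        (RingHom.ker (restrict (K := K) F) : Set (MvPolynomial (Fin n) K)) := fun i =>
      hker.trans (show (s.head).1 ≤ (s i).1 from s.head_le i)
    let s' : LTSeries (PrimeSpectrum.zeroLocus
        (RingHom.ker (restrict (K := K) F) : Set (MvPolynomial (Fin n) K))) :=
      ⟨s.length, fun i => ⟨(s i).1, hs i⟩, fun i => s.step i⟩
    have h1 : (s.length : WithBot ℕ∞) ≤ ringKrullDim (MvPolynomial (Fin n) K ⧸
        RingHom.ker (restrict (K := K) F)) := by
      rw [ringKrullDim_quotient]
      exact Order.LTSeries.length_le_krullDim s'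
    have h2 : ringKrullDim (MvPolynomial (Fin n) K ⧸ RingHom.ker (restrict (K := K) F)) =
        (F.card : ℕ) := by
      rw [← ringKrullDim_mvPolynomial (K := K)]
      exact ringKrullDim_eq_of_ringEquiv (RingHom.quotientKerEquivOfSurjective
        (f := (restrict (K := K) F).toRingHom)
        fun q => ⟨rename Subtype.val q, restrict_rename F q⟩)
    exact h1.trans (h2.trans_le (by exact_mod_cast hmax F hF))
  · obtain ⟨F, hF, rfl⟩ := hD
    rw [← ringKrullDim_mvPolynomial (K := K)]
    refine ringKrullDim_le_of_surjective
      (Ideal.Quotient.lift J (restrict (K := K) F).toRingHom (h.le_ker_restrict hF)) ?_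
    exact Ideal.Quotient.lift_surjective_of_surjective _ _
      fun q => ⟨rename Subtype.val q, restrict_rename F q⟩

end KrullDimension

/-- A face `F` contributes `z^|F| (1 - z)^(D - |F|)` to the numerator, and at `z = 1` only faces of
size `D` survive. -/
theorem IsSquarefreeIdeal.mult_eq {J : Ideal (MvPolynomial (Fin n) K)}
    {p : Finset (Fin n) → Prop} (h : IsSquarefreeIdeal J p) {D : ℕ}
    (hD : ∃ F, ¬p F ∧ F.card = D) (hmax : ∀ F, ¬p F → F.card ≤ D) :
    mult J = ((faces p).filter fun F => F.card = D).card := by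
  let Q : Polynomial ℤ := ∑ F ∈ faces p, Polynomial.X ^ F.card * (1 - Polynomial.X) ^ (D - F.card)
  have hQ : (Q : PowerSeries ℤ) = hilbertSeries J * (1 - PowerSeries.X) ^ D := by
    rw [h.hilbertSeries_eq, Finset.sum_mul, ← Polynomial.coeToPowerSeries.ringHom_apply, map_sum]
    refine Finset.sum_congr rfl fun F hF => ?_
    rw [geomSeries_pow_mul_one_sub_pow (hmax F (mem_faces.1 hF))]
    simp [Polynomial.coeToPowerSeries.ringHom_apply]
  have hdim := h.ringKrullDim_eq hD hmax
  have hex : ∃ Q, IsHilbertNumerator J Q := ⟨Q, D, hdim, hQ⟩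
  rw [mult, dif_pos hex]
  -- The chosen numerator is unique: the Krull dimension fixes the exponent, and polynomials embed
  -- in power series.
  have hchoose : hex.choose = Q := by
    obtain ⟨D', hD', hQ'⟩ := hex.choose_spec
    obtain rfl : D' = D := by
      rw [hdim] at hD'
      exact_mod_cast hD'.symm
    exact Polynomial.coe_injective ℤ (hQ'.trans hQ.symm)
  rw [hchoose, Finset.card_filter, Nat.cast_sum, Polynomial.eval_finsetSum]
  refine Finset.sum_congr rfl fun F hF => ?_
  by_cases hc : F.card = D
  · simp [hc]
  · have : D - F.card ≠ 0 := by
      have := hmax F (mem_faces.1 hF)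
      omega
    simp [hc, this]

open Classical in
/-- The multiplicity is the number of vertex covers of minimal size `q`. -/
theorem IsSquarefreeIdeal.mult_eq_card_covers {J : Ideal (MvPolynomial (Fin n) K)}
    {p : Finset (Fin n) → Prop} (h : IsSquarefreeIdeal J p) {q : ℕ}
    (hq : ∃ C : Finset (Fin n), ¬p Cᶜ ∧ C.card = q)
    (hmin : ∀ C : Finset (Fin n), ¬p Cᶜ → q ≤ C.card) :
    mult J = (Finset.univ.filter fun C : Finset (Fin n) => ¬p Cᶜ ∧ C.card = q).card := by
  have hcard : ∀ C : Finset (Fin n), Cᶜ.card = n - C.card := fun C => by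
    rw [Finset.card_compl, Fintype.card_fin]
  have hle : ∀ C : Finset (Fin n), C.card ≤ n := fun C =>
    (Finset.card_le_univ C).trans_eq (Fintype.card_fin n)
  rw [h.mult_eq (D := n - q)]
  · congr 1
    refine Finset.card_bij (fun F _ => Fᶜ) ?_ (fun _ _ _ _ => compl_injective.eq_iff.1)
      fun C hC => ⟨Cᶜ, ?_, compl_compl C⟩
    · intro F hF
      simp only [Finset.mem_filter, mem_faces, Finset.mem_univ, true_and, compl_compl] at hF ⊢
      refine ⟨hF.1, ?_⟩
      have := hmin Fᶜ (by rw [compl_compl]; exact hF.1)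
      have := hcard F
      have := hle F
      omega
    · simp only [Finset.mem_filter, mem_faces, Finset.mem_univ, true_and] at hC ⊢
      exact ⟨hC.1, by rw [hcard, hC.2]⟩
  · obtain ⟨C, hC, rfl⟩ := hq
    exact ⟨Cᶜ, hC, hcard C⟩
  · intro F hF
    have := hmin Fᶜ (by rwa [compl_compl])
    have := hcard F
    have := hle F
    omega

/-- The zero ring has dimension `⊥`, so no numerator exists and the default value `0` applies. -/
theorem mult_top : mult (⊤ : Ideal (MvPolynomial (Fin n) K)) = 0 := by
  refine dif_neg ?_
  rintro ⟨Q, D, hD, -⟩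
  have : Subsingleton (MvPolynomial (Fin n) K ⧸ (⊤ : Ideal (MvPolynomial (Fin n) K))) :=
    Ideal.Quotient.subsingleton_iff.2 rfl
  rw [ringKrullDim_eq_bot_of_subsingleton] at hD
  exact WithBot.bot_ne_natCast D hD

/-! ### Prefix counts and the Borel order. -/

section Prefixes

/-- The number of elements of `w` that are at most `t`. -/
def cnt (w : Finset (Fin n)) (t : Fin n) : ℕ := (w.filter (· ≤ t)).card

lemma cnt_mono {v w : Finset (Fin n)} (h : v ⊆ w) (t : Fin n) : cnt v t ≤ cnt w t :=
  Finset.card_le_card (Finset.filter_subset_filter _ h)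

lemma cnt_le_card (w : Finset (Fin n)) (t : Fin n) : cnt w t ≤ w.card :=
  Finset.card_filter_le _ _

lemma cnt_eq_card {w : Finset (Fin n)} {t : Fin n} (h : ∀ i ∈ w, i ≤ t) : cnt w t = w.card := by
  rw [cnt, Finset.filter_true_of_mem h]

lemma cnt_eq_card_iff {w : Finset (Fin n)} {t : Fin n} : cnt w t = w.card ↔ ∀ i ∈ w, i ≤ t :=
  Finset.card_filter_eq_iff

lemma cnt_erase_of_lt {w : Finset (Fin n)} {m t : Fin n} (h : t < m) :
    cnt (w.erase m) t = cnt w t := by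
  rw [cnt, cnt]
  congr 1
  ext i
  simp only [Finset.mem_filter, Finset.mem_erase]
  exact ⟨fun hi => ⟨hi.1.2, hi.2⟩, fun hi => ⟨⟨(hi.2.trans_lt h).ne, hi.1⟩, hi.2⟩⟩

lemma cnt_le_cnt_insert_erase {w : Finset (Fin n)} {i j : Fin n} (hi : i ∉ w) (hij : i < j)
    (t : Fin n) : cnt w t ≤ cnt (insert i (w.erase j)) t := by
  by_cases hj : j ∈ w ∧ j ≤ t
  · have h : insert i ((w.filter (· ≤ t)).erase j) ⊆ (insert i (w.erase j)).filter (· ≤ t) := by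
      intro x hx
      simp only [Finset.mem_filter, Finset.mem_insert, Finset.mem_erase] at hx ⊢
      rcases hx with rfl | hx
      · exact ⟨Or.inl rfl, hij.le.trans hj.2⟩
      · exact ⟨Or.inr ⟨hx.1, hx.2.1⟩, hx.2.2⟩
    refine le_trans ?_ (Finset.card_le_card h)
    rw [Finset.card_insert_of_notMem (by simp [hi]), Finset.card_erase_add_one (by simp [hj])]
    rfl
  · refine Finset.card_le_card fun x hx => ?_
    simp only [Finset.mem_filter, Finset.mem_insert, Finset.mem_erase] at hx ⊢
    refine ⟨Or.inr ⟨?_, hx.1⟩, hx.2⟩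
    rintro rfl
    exact hj hx

lemma cnt_compl (w : Finset (Fin n)) (t : Fin n) : cnt w t + cnt wᶜ t = t + 1 := by
  rw [cnt, cnt, ← Finset.card_union_of_disjoint
    (Finset.disjoint_filter_filter disjoint_compl_right), ← Finset.filter_union,
    Finset.union_compl, ← Fin.card_Iic]
  congr 1
  ext; simp

/-- The prefix counts of `w` are at least those of `U`. For sets of equal size this is the Borel
order. -/
def Dominates (U w : Finset (Fin n)) : Prop := ∀ t, cnt U t ≤ cnt w t

lemma Dominates.card_le {U w : Finset (Fin n)} (h : Dominates U w) : U.card ≤ w.card := by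
  rcases U.eq_empty_or_nonempty with rfl | hU
  · simp
  · have h1 := h (U.max' hU)
    rw [cnt_eq_card fun i hi => U.le_max' i hi] at h1
    exact h1.trans (cnt_le_card _ _)

/-- Delete the largest element while there are too many: prefixes ending before it are unchanged,
and later ones still contain at least `|U|` elements. -/
lemma Dominates.exists_subset {U F : Finset (Fin n)} (h : Dominates U F) :
    ∃ w ⊆ F, w.card = U.card ∧ Dominates U w := by
  induction F using Finset.strongInduction with
  | H F ih =>
    rcases h.card_le.eq_or_lt with heq | hlt
    · exact ⟨F, subset_rfl, heq.symm, h⟩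
    · have hF : F.Nonempty := Finset.card_pos.1 (by omega)
      have hm := F.max'_mem hF
      obtain ⟨w, hw, hc, hd⟩ := ih (F.erase (F.max' hF)) (Finset.erase_ssubset hm) fun t => by
        rcases lt_or_ge t (F.max' hF) with ht | ht
        · rw [cnt_erase_of_lt ht]
          exact h t
        · rw [cnt_eq_card (w := F.erase _) fun i hi =>
            (F.le_max' i (Finset.mem_of_mem_erase hi)).trans ht, Finset.card_erase_of_mem hm]
          have := cnt_le_card U t
          omega
      exact ⟨w, hw.trans (Finset.erase_subset _ _), hc, hd⟩

open Classical in
/-- The supports of the generators of the squarefree principal Borel ideal. -/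
def borelSets (U : Finset (Fin n)) : Finset (Finset (Fin n)) :=
  Finset.univ.filter fun w => w.card = U.card ∧ Dominates U w

lemma mem_borelSets {U w : Finset (Fin n)} :
    w ∈ borelSets U ↔ w.card = U.card ∧ Dominates U w := by
  simp [borelSets]

lemma self_mem_borelSets (U : Finset (Fin n)) : U ∈ borelSets U :=
  mem_borelSets.2 ⟨rfl, fun _ => le_rfl⟩

lemma card_insert_erase {w : Finset (Fin n)} {i j : Fin n} (hi : i ∉ w) (hj : j ∈ w) :
    (insert i (w.erase j)).card = w.card := by
  rw [Finset.card_insert_of_notMem fun h => hi (Finset.mem_of_mem_erase h),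
    Finset.card_erase_add_one hj]

lemma isShifted_borelSets (U : Finset (Fin n)) : IsShifted (borelSets U) := by
  refine ⟨fun v hv w hw => (mem_borelSets.1 hv).1.trans (mem_borelSets.1 hw).1.symm,
    fun w hw i hi j hj hij => ?_⟩
  obtain ⟨hc, hd⟩ := mem_borelSets.1 hw
  exact mem_borelSets.2 ⟨(card_insert_erase hi hj).trans hc,
    fun t => (hd t).trans (cnt_le_cnt_insert_erase hi hij t)⟩

lemma exists_borelSets_le_iff {U : Finset (Fin n)} {m : Fin n →₀ ℕ} :
    (∃ w ∈ borelSets U, ind w ≤ m) ↔ Dominates U m.support := by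
  constructor
  · rintro ⟨w, hw, hwm⟩ t
    exact ((mem_borelSets.1 hw).2 t).trans (cnt_mono (ind_le_iff.1 hwm) t)
  · intro h
    obtain ⟨w, hw, hcd⟩ := h.exists_subset
    exact ⟨w, mem_borelSets.2 hcd, ind_le_iff.2 hw⟩

/-- Every set below `v` in the Borel order is obtained from `v` by replacing elements by smaller
ones. -/
theorem borel_induction {p : Finset (Fin n) → Prop}
    (hp : ∀ v, p v → ∀ j ∈ v, ∀ i ∉ v, i < j → p (insert i (v.erase j)))
    {v w : Finset (Fin n)} (hv : p v) (hc : w.card = v.card) (hd : Dominates v w) : p w := by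
  induction h : (v \ w).card using Nat.strong_induction_on generalizing v with
  | _ N ih =>
    rcases (v \ w).eq_empty_or_nonempty with he | hne
    · rwa [← Finset.eq_of_subset_of_card_le (Finset.sdiff_eq_empty_iff_subset.1 he) hc.le]
    set j := (v \ w).min' hne
    obtain ⟨hjv, hjw⟩ := Finset.mem_sdiff.1 ((v \ w).min'_mem hne)
    have hlt : ∀ x ∈ v, x < j → x ∈ w := fun x hx hxj => by
      by_contra hxw
      exact hxj.not_ge (Finset.min'_le _ _ (Finset.mem_sdiff.2 ⟨hx, hxw⟩))
    -- With `j` the least element of `v \ w`, domination at `j` forces `w` to have an earlier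
    -- element outside `v`. Trading `j` for it shrinks `v \ w`.
    obtain ⟨m, hmw, hmv, hmj⟩ : ∃ m ∈ w, m ∉ v ∧ m < j := by
      by_contra! hno
      have hss : w.filter (· ≤ j) ⊂ v.filter (· ≤ j) := by
        refine (Finset.ssubset_iff_of_subset fun x hx => ?_).2
          ⟨j, Finset.mem_filter.2 ⟨hjv, le_rfl⟩, fun h => hjw (Finset.mem_filter.1 h).1⟩
        obtain ⟨hxw, hxj⟩ := Finset.mem_filter.1 hx
        refine Finset.mem_filter.2 ⟨?_, hxj⟩
        by_contra hxv
        obtain rfl := le_antisymm hxj (hno x hxw hxv)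
        exact hjw hxw
      exact (hd j).not_gt (Finset.card_lt_card hss)
    refine ih _ ?_ (hp v hv j hjv m hmv hmj) (by rw [card_insert_erase hmv hjv, hc])
      (fun t => ?_) rfl
    · rw [← h]
      refine Finset.card_lt_card ((Finset.ssubset_iff_of_subset fun x hx => ?_).2
        ⟨j, Finset.mem_sdiff.2 ⟨hjv, hjw⟩, by simp [hmj.ne']⟩)
      simp only [Finset.mem_sdiff, Finset.mem_insert, Finset.mem_erase] at hx ⊢
      rcases hx with ⟨rfl | hx, hxw⟩
      · exact absurd hmw hxw
      · exact ⟨hx.2, hxw⟩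
    -- Before `j` the new set lies inside `w`; from `j` on its prefix counts are those of `v`.
    · rcases lt_or_ge t j with htj | htj
      · refine Finset.card_le_card fun x hx => ?_
        simp only [Finset.mem_filter, Finset.mem_insert, Finset.mem_erase] at hx ⊢
        rcases hx with ⟨rfl | hx, hxt⟩
        · exact ⟨hmw, hxt⟩
        · exact ⟨hlt x hx.2 (hxt.trans_lt htj), hxt⟩
      · refine le_trans ?_ (hd t)
        rw [cnt, Finset.filter_insert, if_pos (hmj.le.trans htj), Finset.filter_erase,
          Finset.card_insert_of_notMem (by simp [hmv]),
          Finset.card_erase_add_one (Finset.mem_filter.2 ⟨hjv, htj⟩)]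
        rfl

end Prefixes

/-! ### Generators of the principal Borel ideal and of its homological shifts. -/

section PrincipalBorel

lemma eq_ind_support {u : Fin n →₀ ℕ} (hu : KBounded 1 u) : u = ind u.support := by
  ext i
  rw [ind_apply]
  have := hu i
  by_cases h : u i = 0
  · simp [h]
  · rw [if_pos (Finsupp.mem_support_iff.2 h)]
    omega

lemma kBounded_ind (w : Finset (Fin n)) : KBounded 1 (ind w) := fun i => by
  rw [ind_apply]
  split_ifs <;> simp

lemma ind_sub_add {v : Finset (Fin n)} {i j : Fin n} (hj : j ∈ v) (hi : i ∉ v) :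
    ind v - Finsupp.single j 1 + Finsupp.single i 1 = ind (insert i (v.erase j)) := by
  have hij : i ≠ j := by rintro rfl; exact hi hj
  ext x
  simp only [Finsupp.add_apply, Finsupp.tsub_apply, ind_apply, Finsupp.single_apply,
    Finset.mem_insert, Finset.mem_erase]
  rcases eq_or_ne x i with rfl | hxi
  · simp [hi, hij.symm]
  rcases eq_or_ne x j with rfl | hxj
  · simp [hj, hij, hxi]
  · simp [hxi, hxj, hxi.symm, hxj.symm]

theorem mem_span_borelSets {U : Finset (Fin n)} {q : MvPolynomial (Fin n) K} :
    q ∈ Ideal.span ((fun b => monomial b (1 : K)) '' (ind '' (borelSets U : Set (Finset (Fin n)))))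
      ↔ ∀ m ∈ q.support, Dominates U m.support := by
  rw [mem_ideal_span_monomial_image]
  refine forall₂_congr fun m _ => ?_
  rw [← exists_borelSets_le_iff]
  simp

lemma monomial_mem_iff_of_forall {I : Ideal (MvPolynomial (Fin n) K)} {p : (Fin n →₀ ℕ) → Prop}
    (hI : ∀ q, q ∈ I ↔ ∀ m ∈ q.support, p m) (m : Fin n →₀ ℕ) :
    monomial m (1 : K) ∈ I ↔ p m := by
  rw [hI]
  simp

/-- Lowering an index cannot decrease prefix counts, so the dominating sets span a Borel ideal;
`borel_induction` reaches each of its generators from `u` inside any Borel ideal. -/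
theorem principalBorel_eq {u : Fin n →₀ ℕ} (hu : KBounded 1 u) :
    principalBorel K 1 u = Ideal.span
      ((fun b => monomial b (1 : K)) '' (ind '' (borelSets u.support : Set (Finset (Fin n))))) := by
  apply le_antisymm
  · refine sInf_le ⟨⟨⟨_, ?_, rfl⟩, ?_⟩, ?_⟩
    · rintro _ ⟨w, -, rfl⟩
      exact kBounded_ind w
    · intro v hv hvI j hj i hij hbd
      rw [monomial_mem_iff_of_forall fun _ => mem_span_borelSets] at hvI ⊢
      have hi : i ∉ v.support := by
        intro hi
        have h1 := hbd i
        rw [Finsupp.mem_support_iff] at hi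
        simp only [Finsupp.add_apply, Finsupp.tsub_apply, Finsupp.single_apply, if_neg hij.ne',
          if_true] at h1
        omega
      rw [eq_ind_support hv, ind_sub_add hj hi, support_ind]
      exact fun t => (hvI t).trans (cnt_le_cnt_insert_erase hi hij t)
    · rw [monomial_mem_iff_of_forall fun _ => mem_span_borelSets]
      exact fun _ => le_rfl
  · refine le_sInf fun J hJ => Ideal.span_le.2 ?_
    rintro _ ⟨_, ⟨w, hw, rfl⟩, rfl⟩
    obtain ⟨hc, hd⟩ := mem_borelSets.1 hw
    refine borel_induction (p := fun w => monomial (ind w) (1 : K) ∈ J) (v := u.support)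
      (fun v hv j hj i hi hij => ?_) ?_ hc hd
    · have h := hJ.1.2 (ind v) (kBounded_ind v) hv j (by rwa [support_ind]) i hij
      rw [ind_sub_add hj hi] at h
      exact h (kBounded_ind _)
    · rw [← eq_ind_support hu]
      exact hJ.2

theorem homologicalShift_principalBorel {u : Fin n →₀ ℕ} (hu : KBounded 1 u) (k : ℕ) :
    homologicalShift k (principalBorel K 1 u) = Ideal.span
      ((fun b => monomial b (1 : K)) '' stableDegrees (borelSets u.support) k) := by
  refine ((isShifted_borelSets u.support).hasResolution K).homologicalShift_eq (fun q => ?_)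
    (D := u.support.card) (fun i b hb => ?_) k
  · rw [principalBorel_eq hu, mem_span_borelSets]
    exact forall₂_congr fun m _ => exists_borelSets_le_iff.symm
  · obtain ⟨w, hw, σ, hσ, rfl, rfl⟩ := hb
    rw [degree_ind, Finset.card_union_of_disjoint (disjoint_gapSet hσ), (mem_borelSets.1 hw).1,
      add_comm]

end PrincipalBorel

/-! ### Supports of monomials in the homological shift ideals. -/

section HomologicalShift

/-- The condition on the support of a monomial to belong to the homological shift ideal. -/
def IsShiftSupport (U : Finset (Fin n)) (M : Fin n) (k : ℕ) (F : Finset (Fin n)) : Prop :=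
  (∀ t < M, cnt U t ≤ cnt F t) ∧ U.card + k ≤ cnt F M

/-- For the converse, give `w` the largest available element `x ≤ M` and choose the rest to dominate
`U` without `M`. Everything else available is below `x`, hence a gap of `w`, and there is room for
`σ`. -/
theorem exists_stableDegrees_le_iff {U : Finset (Fin n)} {M : Fin n} (hM : M ∈ U)
    (hmax : ∀ i ∈ U, i ≤ M) {k : ℕ} {m : Fin n →₀ ℕ} :
    (∃ b ∈ stableDegrees (borelSets U) k, b ≤ m) ↔ IsShiftSupport U M k m.support := by
  constructor
  · rintro ⟨_, ⟨w, hw, σ, hσ, rfl, rfl⟩, hle⟩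
    obtain ⟨hc, hd⟩ := mem_borelSets.1 hw
    rw [ind_le_iff] at hle
    refine ⟨fun t _ => (hd t).trans (cnt_mono (Finset.subset_union_right.trans hle) t), ?_⟩
    have hwM : ∀ i ∈ w, i ≤ M := by
      refine cnt_eq_card_iff.1 (le_antisymm (cnt_le_card _ _) ?_)
      rw [hc, ← cnt_eq_card hmax]
      exact hd M
    refine le_trans ?_ (cnt_mono hle M)
    rw [cnt_eq_card, Finset.card_union_of_disjoint (disjoint_gapSet hσ), hc, add_comm]
    intro i hi
    rcases Finset.mem_union.1 hi with hi | hi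
    · obtain ⟨-, j, hj, hij⟩ := mem_gapSet.1 (hσ hi)
      exact hij.le.trans (hwM j hj)
    · exact hwM i hi
  · rintro ⟨h1, h2⟩
    have hUpos : 0 < U.card := Finset.card_pos.2 ⟨M, hM⟩
    set F := m.support.filter (· ≤ M)
    have hFcard : U.card + k ≤ F.card := h2
    have hF : F.Nonempty := Finset.card_pos.1 (by omega)
    have hFM : ∀ i ∈ F, i ≤ M := fun i hi => (Finset.mem_filter.1 hi).2
    have hFcnt : ∀ t ≤ M, cnt F t = cnt m.support t := fun t ht => by
      rw [cnt, cnt, Finset.filter_filter]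
      congr 1
      ext i
      simp only [Finset.mem_filter]
      exact and_congr_right fun _ => ⟨fun h => h.2, fun h => ⟨h.trans ht, h⟩⟩
    set x := F.max' hF
    have hx := F.max'_mem hF
    obtain ⟨w, hwF, hwc, hwd⟩ : ∃ w ⊆ F.erase x, w.card = (U.erase M).card ∧
        Dominates (U.erase M) w := by
      refine Dominates.exists_subset fun t => ?_
      rcases lt_or_ge t x with ht | ht
      · have htM := ht.trans_le (hFM x hx)
        rw [cnt_erase_of_lt ht, cnt_erase_of_lt htM, hFcnt t htM.le]
        exact h1 t htM
      · rw [cnt_eq_card (w := F.erase x) fun i hi =>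
          (F.le_max' i (Finset.mem_of_mem_erase hi)).trans ht, Finset.card_erase_of_mem hx]
        have := cnt_le_card (U.erase M) t
        rw [Finset.card_erase_of_mem hM] at this
        omega
    have hxw : x ∉ w := fun h => Finset.notMem_erase _ _ (hwF h)
    have hcard : (insert x w).card = U.card := by
      rw [Finset.card_insert_of_notMem hxw, hwc, Finset.card_erase_add_one hM]
    have hsub : insert x w ⊆ F :=
      Finset.insert_subset hx (hwF.trans (Finset.erase_subset _ _))
    have hmem : insert x w ∈ borelSets U := by
      refine mem_borelSets.2 ⟨hcard, fun t => ?_⟩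
      rcases lt_or_ge t M with ht | ht
      · rw [← cnt_erase_of_lt ht]
        exact (hwd t).trans (cnt_mono (Finset.subset_insert _ _) t)
      · rw [cnt_eq_card (w := insert x w) fun i hi => (hFM i (hsub hi)).trans ht, hcard]
        exact cnt_le_card _ _
    obtain ⟨σ, hσ, hσc⟩ := Finset.exists_subset_card_eq (s := F \ insert x w) (n := k) (by
      rw [Finset.card_sdiff_of_subset hsub, hcard]
      omega)
    refine ⟨_, ⟨insert x w, hmem, σ, fun i hi => ?_, hσc, rfl⟩, ind_le_iff.2 ?_⟩
    · obtain ⟨hiF, hiw⟩ := Finset.mem_sdiff.1 (hσ hi)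
      refine mem_gapSet.2 ⟨hiw, x, Finset.mem_insert_self _ _, lt_of_le_of_ne (F.le_max' i hiF) ?_⟩
      rintro rfl
      exact hiw (Finset.mem_insert_self _ _)
    · exact (Finset.union_subset (hσ.trans Finset.sdiff_subset) hsub).trans
        (Finset.filter_subset _ _)

theorem isSquarefreeIdeal_homologicalShift {u : Fin n →₀ ℕ} (hu : KBounded 1 u) {M : Fin n}
    (hM : M ∈ u.support) (hmax : ∀ i ∈ u.support, i ≤ M) (k : ℕ) :
    IsSquarefreeIdeal (homologicalShift k (principalBorel K 1 u))
      (IsShiftSupport u.support M k) := by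
  refine ⟨fun q => ?_, fun F G hFG hF => ⟨fun t ht => (hF.1 t ht).trans (cnt_mono hFG t),
    hF.2.trans (cnt_mono hFG M)⟩⟩
  rw [homologicalShift_principalBorel hu, mem_ideal_span_monomial_image]
  exact forall₂_congr fun m _ => exists_stableDegrees_le_iff hM hmax

/-- A set and its complement have prefix counts adding up to `t + 1`, which turns element counts of
`U` into gap counts. -/
lemma not_isShiftSupport_compl_iff {U : Finset (Fin n)} {M : Fin n} (hmax : ∀ i ∈ U, i ≤ M) {k : ℕ}
    {C : Finset (Fin n)} : ¬IsShiftSupport U M k Cᶜ ↔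
      (∃ t < M, cnt Uᶜ t < cnt C t) ∨ cnt Uᶜ M < cnt C M + k := by
  rw [IsShiftSupport, not_and_or]
  push Not
  refine or_congr (exists_congr fun t => and_congr_right fun _ => ?_) ?_
  · have := cnt_compl U t
    have := cnt_compl C t
    omega
  · have := cnt_compl U M
    have := cnt_compl C M
    have := cnt_eq_card hmax
    omega

end HomologicalShift

/-! ### The first block and the growth of the gap count. -/

/-- `[i, j]` is the first maximal interval in `U`. -/
structure IsFirstInterval (U : Finset (Fin n)) (i j : Fin n) : Prop where
  le : i ≤ j
  subset : Finset.Icc i j ⊆ U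
  min_le : ∀ s ∈ U, i ≤ s
  notMem : ∀ x : Fin n, (x : ℕ) = j + 1 → x ∉ U

lemma IsFirstBlock.isFirstInterval {u : Fin n →₀ ℕ} {i j : Fin n}
    (h : IsFirstBlock u (Finset.Icc i j)) : IsFirstInterval u.support i j := by
  obtain ⟨⟨⟨hsub, i', j', hij', heq⟩, hmax⟩, i₀, hi₀, hmin⟩ := h
  have hij : i ≤ j := by
    have : (Finset.Icc i j).Nonempty := by rw [heq]; exact Finset.nonempty_Icc.2 hij'
    exact Finset.nonempty_Icc.1 this
  refine ⟨hij, hsub, fun s hs => (Finset.mem_Icc.1 hi₀).1.trans (hmin s hs), fun x hx hxu => ?_⟩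
  have hjx : j ≤ x := by rw [Fin.le_def]; omega
  have hblock : IsBlock u (Finset.Icc i x) := by
    refine ⟨fun y hy => ?_, i, x, hij.trans hjx, rfl⟩
    obtain ⟨h1, h2⟩ := Finset.mem_Icc.1 hy
    rcases h2.eq_or_lt with rfl | h2
    · exact hxu
    · exact hsub (Finset.mem_Icc.2 ⟨h1, by rw [Fin.lt_def] at h2; rw [Fin.le_def]; omega⟩)
  have h1 := hmax hblock (Finset.Icc_subset_Icc le_rfl hjx)
    (Finset.mem_Icc.2 ⟨hij.trans hjx, le_rfl⟩)
  have h2 := (Finset.mem_Icc.1 h1).2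
  rw [Fin.le_def] at h2
  omega

lemma exists_isFirstInterval {U : Finset (Fin n)} (hU : U.Nonempty) :
    ∃ i j, IsFirstInterval U i j := by
  classical
  set i := U.min' hU
  have hi : i ∈ U := U.min'_mem hU
  set T := Finset.univ.filter fun x => i ≤ x ∧ Finset.Icc i x ⊆ U
  have hT : i ∈ T := by simp [T, hi]
  obtain ⟨-, hij, hsub⟩ := Finset.mem_filter.1 (T.max'_mem ⟨i, hT⟩)
  refine ⟨i, T.max' ⟨i, hT⟩, hij, hsub, fun s hs => U.min'_le s hs, fun x hx hxU => ?_⟩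
  have hxT : x ∈ T := by
    refine Finset.mem_filter.2 ⟨Finset.mem_univ _, ?_, fun y hy => ?_⟩
    · rw [Fin.le_def] at hij ⊢; omega
    · obtain ⟨h1, h2⟩ := Finset.mem_Icc.1 hy
      rcases h2.eq_or_lt with rfl | h2
      · exact hxU
      · exact hsub (Finset.mem_Icc.2 ⟨h1, by rw [Fin.lt_def] at h2; rw [Fin.le_def]; omega⟩)
  have := T.le_max' x hxT
  rw [Fin.le_def] at this
  omega

section GapCount

variable {U : Finset (Fin n)} {i j : Fin n}

lemma IsFirstInterval.cnt_compl_of_lt (h : IsFirstInterval U i j) {t : Fin n} (ht : t < i) :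
    cnt Uᶜ t = t + 1 := by
  rw [← cnt_compl U t, right_eq_add, cnt, Finset.card_eq_zero, Finset.filter_eq_empty_iff]
  exact fun s hs hst => (h.min_le s hs).not_gt (hst.trans_lt ht)

lemma IsFirstInterval.le_cnt_compl (h : IsFirstInterval U i j) {t : Fin n} (ht : i ≤ t) :
    (i : ℕ) ≤ cnt Uᶜ t := by
  rw [← Fin.card_Iio]
  refine Finset.card_le_card fun x hx => ?_
  rw [Finset.mem_Iio] at hx
  exact Finset.mem_filter.2
    ⟨Finset.mem_compl.2 fun hxU => (h.min_le x hxU).not_gt hx, hx.le.trans ht⟩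

lemma IsFirstInterval.cnt_compl_right (h : IsFirstInterval U i j) : cnt Uᶜ j = i := by
  rw [← Fin.card_Iio, cnt]
  congr 1
  ext x
  simp only [Finset.mem_filter, Finset.mem_compl, Finset.mem_Iio]
  constructor
  · rintro ⟨hx, hxj⟩
    by_contra hix
    exact hx (h.subset (Finset.mem_Icc.2 ⟨not_lt.1 hix, hxj⟩))
  · exact fun hx => ⟨fun hxU => (h.min_le x hxU).not_gt hx, hx.le.trans h.le⟩

lemma IsFirstInterval.lt_cnt_compl (h : IsFirstInterval U i j) {t : Fin n} (ht : j < t) :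
    (i : ℕ) < cnt Uᶜ t := by
  rw [← h.cnt_compl_right]
  rw [Fin.lt_def] at ht
  let x : Fin n := ⟨j + 1, by omega⟩
  refine Finset.card_lt_card ((Finset.ssubset_iff_of_subset fun y hy => ?_).2
    ⟨x, Finset.mem_filter.2 ⟨Finset.mem_compl.2 (h.notMem x rfl), ?_⟩, fun hx => ?_⟩)
  · obtain ⟨h1, h2⟩ := Finset.mem_filter.1 hy
    exact Finset.mem_filter.2 ⟨h1, h2.trans (by rw [Fin.le_def]; omega)⟩
  · rw [Fin.le_def]
    exact ht
  · have := (Finset.mem_filter.1 hx).2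
    rw [Fin.le_def] at this
    simp [x] at this

end GapCount

section Gaps

variable {u : Fin n →₀ ℕ} {M : Fin n}

lemma maxVar_eq (hM : M ∈ u.support) (hmax : ∀ i ∈ u.support, i ≤ M) : maxVar u = M + 1 := by
  apply le_antisymm
  · refine Finset.sup_le fun i hi => ?_
    have := hmax i hi
    rw [Fin.le_def] at this
    omega
  · exact Finset.le_sup (f := fun i : Fin n => (i : ℕ) + 1) hM

lemma gaps_eq (hM : M ∈ u.support) (hmax : ∀ i ∈ u.support, i ≤ M) :
    gaps u = u.supportᶜ.filter (· ≤ M) := by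
  ext i
  simp only [gaps, Finset.mem_filter, Finset.mem_univ, true_and, maxVar_eq hM hmax,
    Finset.mem_compl]
  refine and_congr_right fun hi => ?_
  have : i ≠ M := by rintro rfl; exact hi hM
  rw [Fin.le_def]
  rw [Ne, Fin.ext_iff] at this
  omega

lemma card_gaps (hM : M ∈ u.support) (hmax : ∀ i ∈ u.support, i ≤ M) :
    (gaps u).card = cnt u.supportᶜ M := by
  rw [gaps_eq hM hmax, cnt]

lemma IsFirstInterval.right_le {i j : Fin n} (h : IsFirstInterval u.support i j)
    (hmax : ∀ i ∈ u.support, i ≤ M) : j ≤ M :=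
  hmax j (h.subset (Finset.mem_Icc.2 ⟨h.le, le_rfl⟩))

lemma IsFirstInterval.card_gaps_eq {i j : Fin n} (h : IsFirstInterval u.support i j)
    (hM : M ∈ u.support) (hmax : ∀ i ∈ u.support, i ≤ M) :
    (gaps u).card = i + numGapsAbove u j := by
  rw [← h.cnt_compl_right, numGapsAbove,
    ← Finset.card_filter_add_card_filter_not (s := gaps u) (· ≤ j)]
  congr 1
  · rw [gaps_eq hM hmax, Finset.filter_filter, cnt]
    congr 1
    ext x
    simp only [Finset.mem_filter]
    exact and_congr_right fun _ => ⟨fun hx => hx.2, fun hx => ⟨hx.trans (h.right_le hmax), hx⟩⟩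
  · simp only [not_le]

end Gaps

section Multiplicity

variable {u : Fin n →₀ ℕ} {M : Fin n}

/-- If the vertex covers of minimal size are the subsets of an initial segment of size `q`, then
they are counted by a binomial coefficient. -/
lemma mult_homologicalShift_eq_choose (hu : KBounded 1 u) (hM : M ∈ u.support)
    (hmax : ∀ i ∈ u.support, i ≤ M) {k q : ℕ} {x : Fin n} (hqx : q ≤ x + 1)
    (hmin : ∀ C : Finset (Fin n), ((∃ t < M, cnt u.supportᶜ t < cnt C t) ∨
      cnt u.supportᶜ M < cnt C M + k) → q ≤ C.card)
    (hiff : ∀ C : Finset (Fin n), C.card = q → (((∃ t < M, cnt u.supportᶜ t < cnt C t) ∨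
      cnt u.supportᶜ M < cnt C M + k) ↔ C ⊆ Finset.Iic x)) :
    mult (homologicalShift k (principalBorel K 1 u)) = ((x + 1 : ℕ).choose q : ℤ) := by
  classical
  have h := isSquarefreeIdeal_homologicalShift (K := K) hu hM hmax k
  have hcov := fun C => not_isShiftSupport_compl_iff (C := C) (k := k) hmax
  rw [h.mult_eq_card_covers (q := q)]
  · rw [← Fin.card_Iic x, ← Finset.card_powersetCard]
    congr 2
    ext C
    rw [Finset.mem_filter, Finset.mem_powersetCard, hcov, and_comm (a := C ⊆ _)]
    simp only [Finset.mem_univ, true_and]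
    rw [and_comm]
    exact and_congr_right fun hC => hiff C hC
  · obtain ⟨C, hC, hCq⟩ := Finset.exists_subset_card_eq (s := Finset.Iic x) (n := q)
      (by rwa [Fin.card_Iic])
    exact ⟨C, (hcov C).2 ((hiff C hCq).2 hC), hCq⟩
  · exact fun C hC => hmin C ((hcov C).1 hC)

variable {i j : Fin n}

/-- Before `i` every index is missing from `U`, and `C` cannot have more than all of them; so `t ≥
i`, where at least `i` indices are missing. -/
lemma IsFirstInterval.lt_cnt_of_cnt_compl_lt {U : Finset (Fin n)} (h : IsFirstInterval U i j)
    {C : Finset (Fin n)} {t : Fin n} (ht : cnt Uᶜ t < cnt C t) : (i : ℕ) < cnt C t := by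
  rcases lt_or_ge t i with hti | hti
  · rw [h.cnt_compl_of_lt hti] at ht
    have := cnt_compl C t
    omega
  · exact (h.le_cnt_compl hti).trans_lt ht

/-- Here covers of the second kind need more than `i + 1` elements, so the minimal ones are of the
first kind. Beyond `j` the gap count exceeds `i`, which confines those of size `i + 1` to the
indices up to `j`. -/
theorem IsFirstInterval.mult_of_lt (h : IsFirstInterval u.support i j) (hu : KBounded 1 u)
    (hM : M ∈ u.support) (hmax : ∀ i ∈ u.support, i ≤ M) {k : ℕ} (hk : k < numGapsAbove u j) :
    mult (homologicalShift k (principalBorel K 1 u)) = ((j + 1 : ℕ).choose (i + 1) : ℤ) := by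
  have hg := h.card_gaps_eq hM hmax
  rw [card_gaps hM hmax] at hg
  have hjM : j < M := by
    refine lt_of_le_of_ne (h.right_le hmax) ?_
    rintro rfl
    rw [h.cnt_compl_right] at hg
    omega
  refine mult_homologicalShift_eq_choose hu hM hmax
    (by have := h.le; rw [Fin.le_def] at this; omega) (fun C hC => ?_) fun C hC => ⟨?_, fun hCx => ?_⟩
  · rcases hC with ⟨t, -, ht⟩ | hC
    · exact (h.lt_cnt_of_cnt_compl_lt ht).trans_le (cnt_le_card C t)
    · have := cnt_le_card C M
      omega
  · rintro (⟨t, -, ht⟩ | hC')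
    · have h1 := h.lt_cnt_of_cnt_compl_lt ht
      have h2 := cnt_le_card C t
      have htj : t ≤ j := by
        by_contra hjt
        have := h.lt_cnt_compl (not_le.1 hjt)
        omega
      have h3 := cnt_eq_card_iff.1 (show cnt C t = C.card by omega)
      exact fun y hy => Finset.mem_Iic.2 ((h3 y hy).trans htj)
    · have := cnt_le_card C M
      omega
  · refine Or.inl ⟨j, hjM, ?_⟩
    rw [h.cnt_compl_right, cnt_eq_card fun y hy => Finset.mem_Iic.1 (hCx hy), hC]
    exact Nat.lt_succ_self _

/-- Covers of the second kind are now at least as small. Truncated subtraction includes the range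
past all gaps: there the ideal is zero and the empty cover counts once. -/
theorem IsFirstInterval.mult_of_le (h : IsFirstInterval u.support i j) (hu : KBounded 1 u)
    (hM : M ∈ u.support) (hmax : ∀ i ∈ u.support, i ≤ M) {k : ℕ} (hk : numGapsAbove u j ≤ k) :
    mult (homologicalShift k (principalBorel K 1 u)) =
      ((maxVar u).choose (i + 1 - (k - numGapsAbove u j)) : ℤ) := by
  have hg := h.card_gaps_eq hM hmax
  rw [card_gaps hM hmax] at hg
  rw [maxVar_eq hM hmax]
  have hiM := h.le.trans (h.right_le hmax)
  rw [Fin.le_def] at hiM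
  refine mult_homologicalShift_eq_choose hu hM hmax (by omega) (fun C hC => ?_)
    fun C hC => ⟨?_, fun hCx => Or.inr ?_⟩
  · rcases hC with ⟨t, -, ht⟩ | hC
    · have := h.lt_cnt_of_cnt_compl_lt ht
      have := cnt_le_card C t
      omega
    · have := cnt_le_card C M
      omega
  · rintro (⟨t, htM, ht⟩ | hC')
    -- A first-kind cover this small exists only for `k = numGapsAbove u j`, and it already lies in
    -- the initial segment up to `M`.
    · have h1 := h.lt_cnt_of_cnt_compl_lt ht
      have h2 := cnt_le_card C t
      have h3 := cnt_eq_card_iff.1 (show cnt C t = C.card by omega)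
      exact fun y hy => Finset.mem_Iic.2 ((h3 y hy).trans htM.le)
    · have h2 := cnt_le_card C M
      have h3 := cnt_eq_card_iff.1 (show cnt C M = C.card by omega)
      exact fun y hy => Finset.mem_Iic.2 (h3 y hy)
  · rw [cnt_eq_card fun y hy => Finset.mem_Iic.1 (hCx hy), hC]
    omega

end Multiplicity

/-! ### Unimodality and the case of the trivial monomial. -/

section Unimodality

lemma choose_succ_le_choose {N r : ℕ} (h : N ≤ 2 * r + 1) : N.choose (r + 1) ≤ N.choose r := by
  have h1 := Nat.choose_succ_right_eq N r
  have h2 : N.choose r * (N - r) ≤ N.choose r * (r + 1) := Nat.mul_le_mul_left _ (by omega)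
  exact Nat.le_of_mul_le_mul_right (h1.trans_le h2) (Nat.succ_pos r)

/-- A sequence that is constant up to some index and then runs downwards through a row of Pascal's
triangle is unimodal. -/
theorem unimodal_of_choose {f : ℕ → ℤ} {a b N h : ℕ} (hbN : b ≤ N)
    (h1 : ∀ k < h, f k = b.choose a) (h2 : ∀ k, h ≤ k → f k = N.choose (a - (k - h))) :
    Unimodal f := by
  -- At this index the lower entry has descended to the middle of the row; if `a ≤ N / 2`,
  -- truncation puts the peak at `h` itself.
  refine ⟨h + (a - N / 2), monotoneOn_of_le_add_one Set.ordConnected_Iic fun k _ _ hk => ?_,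
    antitoneOn_of_add_one_le Set.ordConnected_Ici fun k _ hk _ => ?_⟩
  · rw [Set.mem_Iic] at hk
    rcases lt_trichotomy (k + 1) h with hkh | hkh | hkh
    · rw [h1 k (by omega), h1 _ hkh]
    · rw [h1 k (by omega), h2 _ hkh.ge, hkh, Nat.sub_self, Nat.sub_zero]
      exact_mod_cast Nat.choose_le_choose a hbN
    · rw [h2 k (by omega), h2 (k + 1) (by omega)]
      obtain ⟨r, hr⟩ : ∃ r, a - (k - h) = r + 1 := ⟨a - (k - h) - 1, by omega⟩
      rw [hr, show a - (k + 1 - h) = r by omega]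
      exact_mod_cast choose_succ_le_choose (by omega)
  · rw [Set.mem_Ici] at hk
    rw [h2 k (by omega), h2 (k + 1) (by omega)]
    rcases Nat.eq_zero_or_pos (a - (k - h)) with h0 | h0
    · rw [h0, show a - (k + 1 - h) = 0 by omega]
    · obtain ⟨r, hr⟩ : ∃ r, a - (k - h) = r + 1 := ⟨a - (k - h) - 1, by omega⟩
      rw [hr, show a - (k + 1 - h) = r by omega]
      exact_mod_cast Nat.choose_le_succ_of_lt_half_left (by omega)

end Unimodality

lemma mult_bot : mult (⊥ : Ideal (MvPolynomial (Fin n) K)) = 1 := by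
  classical
  have h : IsSquarefreeIdeal (⊥ : Ideal (MvPolynomial (Fin n) K)) fun _ => False := by
    refine ⟨fun q => ?_, fun _ _ _ => id⟩
    rw [Ideal.mem_bot, ← support_eq_empty, Finset.eq_empty_iff_forall_notMem]
  rw [h.mult_eq_card_covers (q := 0) ⟨∅, by simp, rfl⟩ fun _ _ => Nat.zero_le _]
  simp [Finset.filter_eq']

lemma stableDegrees_borelSets_empty (k : ℕ) :
    stableDegrees (borelSets (∅ : Finset (Fin n))) k = {b | k = 0 ∧ b = 0} := by
  ext b
  constructor
  · rintro ⟨w, hw, σ, hσ, rfl, rfl⟩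
    obtain rfl : w = ∅ := by simpa using (mem_borelSets.1 hw).1
    obtain rfl : σ = ∅ := Finset.eq_empty_of_forall_notMem fun i hi => by
      simpa using mem_gapSet.1 (hσ hi)
    simp
  · rintro ⟨rfl, rfl⟩
    exact ⟨∅, self_mem_borelSets _, ∅, Finset.empty_subset _, rfl, by simp⟩

/-- For `u = 1` the ideal is `S`, with its only shift in homological degree `0`; the higher shift
ideals vanish and leave `S` as the quotient. -/
lemma mult_homologicalShift_zero (k : ℕ) :
    mult (homologicalShift k (principalBorel K 1 (0 : Fin n →₀ ℕ))) = if k = 0 then 0 else 1 := by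
  rw [homologicalShift_principalBorel fun _ => Nat.zero_le _, Finsupp.support_zero,
    stableDegrees_borelSets_empty]
  split_ifs with hk
  · rw [← mult_top (n := n) (K := K)]
    congr 1
    rw [Ideal.eq_top_iff_one]
    exact Ideal.subset_span ⟨0, ⟨hk, rfl⟩, rfl⟩
  · simp [hk, mult_bot]

end SquarefreeBorel

end

theorem proposition4p4 {K : Type*} [Field K] {n : ℕ} (u : Fin n →₀ ℕ)
    (hu : SquarefreeBorel.KBounded 1 u) (I : Ideal (MvPolynomial (Fin n) K))
    (hI : I = SquarefreeBorel.principalBorel K 1 u) :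
    SquarefreeBorel.Unimodal
        (fun k => SquarefreeBorel.mult (SquarefreeBorel.homologicalShift k I)) ∧
      -- The first block is `[a, b]` with `a = i + 1` and `b = j + 1`.
      ∀ i j : Fin n, SquarefreeBorel.IsFirstBlock u (Finset.Icc i j) →
        (∀ k < SquarefreeBorel.numGapsAbove u j,
          SquarefreeBorel.mult (SquarefreeBorel.homologicalShift k I) =
            (((j : ℕ) + 1).choose ((i : ℕ) + 1) : ℤ)) ∧
        (∀ k, SquarefreeBorel.numGapsAbove u j ≤ k → k ≤ (SquarefreeBorel.gaps u).card →
          SquarefreeBorel.mult (SquarefreeBorel.homologicalShift k I) =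
            ((SquarefreeBorel.maxVar u).choose
              ((i : ℕ) + 1 - (k - SquarefreeBorel.numGapsAbove u j)) : ℤ)) ∧
        (∀ k, (SquarefreeBorel.gaps u).card < k →
          SquarefreeBorel.mult (SquarefreeBorel.homologicalShift k I) = 1) := by
  subst hI
  rcases u.support.eq_empty_or_nonempty with hsupp | hne
  · obtain rfl : u = 0 := Finsupp.support_eq_empty.1 hsupp
    refine ⟨⟨1, ?_, ?_⟩, fun i j hij => ?_⟩
    · refine monotoneOn_of_le_add_one Set.ordConnected_Iic fun k _ _ _ => ?_
      simp only [SquarefreeBorel.mult_homologicalShift_zero]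
      split_ifs <;> simp_all
    · refine antitoneOn_of_add_one_le Set.ordConnected_Ici fun k _ hk _ => ?_
      rw [Set.mem_Ici] at hk
      simp [SquarefreeBorel.mult_homologicalShift_zero, Nat.one_le_iff_ne_zero.1 hk]
    · have h := hij.isFirstInterval
      simpa using h.subset (Finset.left_mem_Icc.2 h.le)
  · set M := u.support.max' hne
    have hM : M ∈ u.support := u.support.max'_mem hne
    have hmax : ∀ i ∈ u.support, i ≤ M := fun i hi => u.support.le_max' i hi
    refine ⟨?_, fun i j hij => ?_⟩
    · obtain ⟨i, j, h⟩ := SquarefreeBorel.exists_isFirstInterval hne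
      refine SquarefreeBorel.unimodal_of_choose (a := i + 1) (b := j + 1) (N := SquarefreeBorel.maxVar u) ?_
        (fun k hk => h.mult_of_lt hu hM hmax hk) fun k hk => h.mult_of_le hu hM hmax hk
      rw [SquarefreeBorel.maxVar_eq hM hmax]
      exact Nat.succ_le_succ (h.right_le hmax)
    · have h := hij.isFirstInterval
      refine ⟨fun k hk => h.mult_of_lt hu hM hmax hk, fun k hk _ => h.mult_of_le hu hM hmax hk,
        fun k hk => ?_⟩
      rw [h.card_gaps_eq hM hmax] at hk
      -- With `g = i + numGapsAbove u j`, the bound `k > g` truncates the lower index to `0`.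
      rw [h.mult_of_le hu hM hmax (by omega), show (i : ℕ) + 1 - (k - SquarefreeBorel.numGapsAbove u j) = 0 by omega,
        Nat.choose_zero_right, Nat.cast_one]
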